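/- **Setting.** For $z\in\{L,C,R\}$ let $$H^z(x,y)=\tfrac{b_z}{2}y^2-\tfrac{c_z}{2}x^2+a_zxy+\alpha_zy-\beta_zx$$ with real coefficients, and let $f_z,g_z$ be real affine functions of $(x,y)$. Consider for small $\epsilon\ge 0$ the piecewise linear system $$\dot x=H_y+\epsilon f,\qquad \dot y=-H_x+\epsilon g, \tag{1}$$ where $(H,f,g)=(H^L,f_L,g_L)$ in the left zone $x\le-1$, $(H^C,f_C,g_C)$ in the central zone $-1\le x\le1$ and $(H^R,f_R,g_R)$ in the right zone $x\ge1$. A point of a switching line $x=\pm1$ is a *crossing point* if the first components of the two adjacent fields have positive product there, and a *tangent point* if one of them vanishes. An *arc* in a zone is an orbit arc of the subsystem of that zone which lies, except for its end points, in the interior of the zone. A *crossing periodic orbit* is a closed chain of finitely many arcs joined at crossing points of the switching lines; a *limit cycle* is a crossing periodic orbit that is isolated among the periodic orbits, i.e. among the crossing ones and the non-constant periodic orbits of a subsystem that stay in its closed zone. **Hypotheses** on (1) with $\epsilon=0$. (H1) The central subsystem has a saddle in $-1<x<1$; each of the other two subsystems has a saddle or a center (anywhere in the plane). (H2) Every point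 of the lines $x=\pm1$ is a crossing point or a tangent point. (H3) There are three periodic annuli of clockwise crossing periodic orbits $L^i_h$, $h\in J_i$, $i=0,1,2$, where $J_i$ is a non-empty open (possibly unbounded) interval: * $L^0_h=\widehat{AA_1}\cup\widehat{A_1A_2}\cup\widehat{A_2A_3}\cup\widehat{A_3A}$ with $A=(1,a(h))$, $A_1=(1,a_1(h))$, $A_2=(-1,a_2(h))$, $A_3=(-1,a_3(h))$, $a_1(h)<a(h)$, $a_2(h)<a_3(h)$; the arcs are run through in this order and lie in the right, central, left and central zone; * $L^1_h=\widehat{BB_1}\cup\widehat{B_1B}$ with $B=(1,b(h))$, $B_1=(1,b_1(h))$, $b_1(h)<b(h)$, with arcs in the right and the central zone; * $L^2_h=\widehat{CC_1}\cup\widehat{C_1C}$ with $C=(-1,c(h))$, $C_1=(-1,c_1(h))$, $c_1(h)<c(h)$, with arcs in the central and the left zone. All these points are crossing points, and $a,b,c$ are injective and differentiable functions of $h$. **Poincaré maps.** Starting at $A(h)$, follow the orbit of (1) through the right, central, left and central zone, each time up to the first point on the switching lines, to the point $A_\epsilon(h)$ on $x=1$. Likewise, $B_\epsilon(h)$ is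 reached from $B(h)$ through the right and then the central zone, and $C_\epsilon(h)$ from $C(h)$ through the central and then the left zone. The first order Melnikov functions $M_0,M_1,M_2$ are defined by $$H^R(A_\epsilon(h))-H^R(A(h))=\epsilon M_0(h)+O(\epsilon^2),\qquad H^R(B_\epsilon(h))-H^R(B(h))=\epsilon M_1(h)+O(\epsilon^2),$$ $$H^C(C_\epsilon(h))-H^C(C(h))=\epsilon M_2(h)+O(\epsilon^2)\qquad(\epsilon\to0^+).$$ **Theorem.** Assume (H1), (H2), (H3). For each $h\in J_0$ (resp. $J_1$, $J_2$) the point $A_\epsilon(h)$ (resp. $B_\epsilon(h)$, $C_\epsilon(h)$) exists for all sufficiently small $\epsilon\ge0$, the above expansions hold, and $$M_0(h)=\frac{H^R_y(A)}{H^C_y(A)}I^0_C+\frac{H^R_y(A)H^C_y(A_3)}{H^C_y(A)H^L_y(A_3)}I^0_L+\frac{H^R_y(A)H^C_y(A_3)H^L_y(A_2)}{H^C_y(A)H^L_y(A_3)H^C_y(A_2)}\bar I^0_C+\frac{H^R_y(A)H^C_y(A_3)H^L_y(A_2)H^C_y(A_1)}{H^C_y(A)H^L_y(A_3)H^C_y(A_2)H^R_y(A_1)}I^0_R,$$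 $$M_1(h)=\frac{H^R_y(B)}{H^C_y(B)}I^1_C+\frac{H^R_y(B)H^C_y(B_1)}{H^C_y(B)H^R_y(B_1)}I^1_R,\qquad M_2(h)=\frac{H^C_y(C)}{H^L_y(C)}I^2_L+\frac{H^C_y(C)H^L_y(C_1)}{H^L_y(C)H^C_y(C_1)}I^2_C,$$ where $$I^0_C=\int_{\widehat{A_3A}}g_Cdx-f_Cdy,\quad I^0_L=\int_{\widehat{A_2A_3}}g_Ldx-f_Ldy,\quad \bar I^0_C=\int_{\widehat{A_1A_2}}g_Cdx-f_Cdy,\quad I^0_R=\int_{\widehat{AA_1}}g_Rdx-f_Rdy,$$ $$I^1_C=\int_{\widehat{B_1B}}g_Cdx-f_Cdy,\quad I^1_R=\int_{\widehat{BB_1}}g_Rdx-f_Rdy,\quad I^2_L=\int_{\widehat{C_1C}}g_Ldx-f_Ldy,\quad I^2_C=\int_{\widehat{CC_1}}g_Cdx-f_Cdy.$$ Furthermore, if for some $i\in\{0,1,2\}$ the function $M_i$ has a simple zero $h^*\in J_i$ (that is, $M_i(h^*)=0\ne M_i'(h^*)$), then for all sufficiently small $\epsilon>0$ system (1) has a unique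 limit cycle near $L^i_{h^*}$: there is a neighbourhood $U_0$ of $L^i_{h^*}$ such that for every neighbourhood $U$ of $L^i_{h^*}$ there is $\epsilon_0>0$ such that, for $0<\epsilon<\epsilon_0$, system (1) has exactly one periodic orbit contained in $U_0$, and this orbit is a limit cycle contained in $U$. -/

import Mathlib

open Set Filter Topology

namespace PWHam

/-- The left (`x ≤ -1`), central (`-1 ≤ x ≤ 1`) and right (`1 ≤ x`) zones. -/
inductive Zone
  | L
  | C
  | R

/-- The open region of a zone. -/
def Zone.region : Zone → Set (ℝ × ℝ)
  | Zone.L => {p | p.1 < -1}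
  | Zone.C => {p | -1 < p.1 ∧ p.1 < 1}
  | Zone.R => {p | 1 < p.1}

/-- Coefficients of `H(x,y) = (b/2) y² - (c/2) x² + a x y + α y - β x`. -/
structure Ham where
  a : ℝ
  b : ℝ
  c : ℝ
  α : ℝ
  β : ℝ

namespace Ham

noncomputable def val (H : Ham) (p : ℝ × ℝ) : ℝ :=
  H.b / 2 * p.2 ^ 2 - H.c / 2 * p.1 ^ 2 + H.a * p.1 * p.2 + H.α * p.2 - H.β * p.1

/-- The partial derivative `H_x`. -/
def dx (H : Ham) (p : ℝ × ℝ) : ℝ := -H.c * p.1 + H.a * p.2 - H.β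

/-- The partial derivative `H_y`. -/
def dy (H : Ham) (p : ℝ × ℝ) : ℝ := H.b * p.2 + H.a * p.1 + H.α

theorem hasDerivAt_dx (H : Ham) (x y : ℝ) :
    HasDerivAt (fun s => H.val (s, y)) (H.dx (x, y)) x := by
  have h := (((((hasDerivAt_id' x).pow 2).const_mul (H.c / 2)).const_sub (H.b / 2 * y ^ 2)).add
    (((hasDerivAt_id' x).const_mul H.a).mul_const y)).add_const (H.α * y)
  refine (h.sub ((hasDerivAt_id' x).const_mul H.β)).congr_deriv ?_
  simp only [dx]
  ring

theorem hasDerivAt_dy (H : Ham) (x y : ℝ) :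
    HasDerivAt (fun s => H.val (x, s)) (H.dy (x, y)) y := by
  have h := (((((hasDerivAt_id' y).pow 2).const_mul (H.b / 2)).sub_const (H.c / 2 * x ^ 2)).add
    ((hasDerivAt_id' y).const_mul (H.a * x))).add ((hasDerivAt_id' y).const_mul H.α)
  refine (h.sub_const (H.β * x)).congr_deriv ?_
  simp only [dy]
  ring

/-- The matrix of the linear part of the Hamiltonian field `(H_y, -H_x)`. -/
def jac (H : Ham) : Matrix (Fin 2) (Fin 2) ℝ := !![H.a, H.b; H.c, -H.a]

/-- `p` is a saddle of the field `(H_y, -H_x)`. -/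
def IsSaddle (H : Ham) (p : ℝ × ℝ) : Prop :=
  H.dy p = 0 ∧ H.dx p = 0 ∧ ∃ l < (0 : ℝ), ∃ m > (0 : ℝ),
    Module.End.HasEigenvalue (Matrix.toLin' H.jac) l ∧
    Module.End.HasEigenvalue (Matrix.toLin' H.jac) m

/-- `p` is a center of the (linear) field `(H_y, -H_x)`: the eigenvalues are `± i ω`, `ω > 0`. -/
def IsCenter (H : Ham) (p : ℝ × ℝ) : Prop :=
  H.dy p = 0 ∧ H.dx p = 0 ∧ ∃ w > (0 : ℝ),
    Module.End.HasEigenvalue (Matrix.toLin' (H.jac.map Complex.ofReal)) ((w : ℂ) * Complex.I)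

end Ham

/-- Coefficients of the affine function `c10 x + c01 y + c00`. -/
structure Aff where
  c10 : ℝ
  c01 : ℝ
  c00 : ℝ

def Aff.val (F : Aff) (p : ℝ × ℝ) : ℝ := F.c10 * p.1 + F.c01 * p.2 + F.c00

/-- The data of a piecewise linear near-Hamiltonian system with three zones:
`x' = H_y + ε f`, `y' = -H_x + ε g`, with a separate `H`, `f`, `g` in each zone. -/
structure Sys where
  H : Zone → Ham
  f : Zone → Aff
  g : Zone → Aff

namespace Sys

/-- The vector field of the subsystem of the zone `z`. -/
def field (S : Sys) (ε : ℝ) (z : Zone) (p : ℝ × ℝ) : ℝ × ℝ :=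
  ((S.H z).dy p + ε * (S.f z).val p, -(S.H z).dx p + ε * (S.g z).val p)

/-- `γ` is a solution of the (linear, hence complete) subsystem of the zone `z`. -/
def IsSolution (S : Sys) (ε : ℝ) (z : Zone) (γ : ℝ → ℝ × ℝ) : Prop :=
  ∀ t, HasDerivAt γ (S.field ε z (γ t)) t

/-- `p` lies on a switching line and the two adjacent fields cross the line there in the
same direction. -/
def IsCrossing (S : Sys) (ε : ℝ) (p : ℝ × ℝ) : Prop :=
  (p.1 = 1 ∧ 0 < (S.field ε Zone.C p).1 * (S.field ε Zone.R p).1) ∨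
  (p.1 = -1 ∧ 0 < (S.field ε Zone.L p).1 * (S.field ε Zone.C p).1)

/-- `p` lies on a switching line and one of the two adjacent fields is tangent to it there. -/
def IsTangent (S : Sys) (ε : ℝ) (p : ℝ × ℝ) : Prop :=
  (p.1 = 1 ∧ ((S.field ε Zone.C p).1 = 0 ∨ (S.field ε Zone.R p).1 = 0)) ∨
  (p.1 = -1 ∧ ((S.field ε Zone.L p).1 = 0 ∨ (S.field ε Zone.C p).1 = 0))

/-- `γ`, on `[0, T]`, is an orbit arc of the subsystem of the zone `z` from `p` to `q` which
lies in the open zone in between. If `p` and `q` are on the switching lines, `q` is thus the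
first point, after `p`, where the orbit meets them. -/
structure IsArc (S : Sys) (ε : ℝ) (z : Zone) (p q : ℝ × ℝ) (γ : ℝ → ℝ × ℝ) (T : ℝ) :
    Prop where
  pos : 0 < T
  sol : S.IsSolution ε z γ
  init : γ 0 = p
  term : γ T = q
  inside : ∀ t ∈ Ioo 0 T, γ t ∈ z.region

def Connects (S : Sys) (ε : ℝ) (z : Zone) (p q : ℝ × ℝ) : Prop :=
  ∃ γ T, S.IsArc ε z p q γ T

/-- `Γ` is a crossing periodic orbit: a closed chain of finitely many arcs that are joined at
crossing points of the switching lines. -/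
def IsCrossingPeriodicOrbit (S : Sys) (ε : ℝ) (Γ : Set (ℝ × ℝ)) : Prop :=
  ∃ (n : ℕ) (z : ℕ → Zone) (p : ℕ → ℝ × ℝ) (γ : ℕ → ℝ → ℝ × ℝ) (T : ℕ → ℝ),
    0 < n ∧ p n = p 0 ∧
    (∀ i < n, S.IsCrossing ε (p i) ∧ S.IsArc ε (z i) (p i) (p (i + 1)) (γ i) (T i)) ∧
    Γ = ⋃ i ∈ Iio n, γ i '' Icc 0 (T i)

/-- `Γ` is a periodic orbit, not an equilibrium, of one subsystem which stays in its zone. -/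
def IsOneZonePeriodicOrbit (S : Sys) (ε : ℝ) (Γ : Set (ℝ × ℝ)) : Prop :=
  ∃ (z : Zone) (γ : ℝ → ℝ × ℝ) (T : ℝ), 0 < T ∧ S.IsSolution ε z γ ∧
    Function.Periodic γ T ∧ S.field ε z (γ 0) ≠ 0 ∧
    (∀ t, γ t ∈ closure z.region) ∧ Γ = range γ

def IsPeriodicOrbit (S : Sys) (ε : ℝ) (Γ : Set (ℝ × ℝ)) : Prop :=
  S.IsCrossingPeriodicOrbit ε Γ ∨ S.IsOneZonePeriodicOrbit ε Γ

/-- A crossing limit cycle: a crossing periodic orbit that is isolated among the periodic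
orbits. -/
def IsLimitCycle (S : Sys) (ε : ℝ) (Γ : Set (ℝ × ℝ)) : Prop :=
  S.IsCrossingPeriodicOrbit ε Γ ∧
    ∃ V : Set (ℝ × ℝ), IsOpen V ∧ Γ ⊆ V ∧
      ∀ Γ' ⊆ V, S.IsPeriodicOrbit ε Γ' → Γ' = Γ

/-- For small `ε > 0` the system has a unique limit cycle near `L`: some fixed neighbourhood
`U₀` of `L` contains exactly one limit cycle (and no other periodic orbit), and this limit cycle
lies in any prescribed neighbourhood `U` of `L` once `ε` is small enough. -/
def UniqueLimitCycleNear (S : Sys) (L : Set (ℝ × ℝ)) : Prop :=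
  ∃ U₀ : Set (ℝ × ℝ), IsOpen U₀ ∧ L ⊆ U₀ ∧
    ∀ U : Set (ℝ × ℝ), IsOpen U → L ⊆ U →
      ∃ ε₀ > 0, ∀ ε ∈ Ioo 0 ε₀, ∃ Γ : Set (ℝ × ℝ), Γ ⊆ U₀ ∧ Γ ⊆ U ∧
        S.IsLimitCycle ε Γ ∧ ∀ Γ' ⊆ U₀, S.IsPeriodicOrbit ε Γ' → Γ' = Γ

/-- Hypothesis (H1). -/
def H1 (S : Sys) : Prop :=
  (∃ p ∈ Zone.C.region, (S.H Zone.C).IsSaddle p) ∧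
  (∃ p, (S.H Zone.L).IsSaddle p ∨ (S.H Zone.L).IsCenter p) ∧
  (∃ p, (S.H Zone.R).IsSaddle p ∨ (S.H Zone.R).IsCenter p)

/-- Hypothesis (H2). -/
def H2 (S : Sys) : Prop :=
  ∀ p : ℝ × ℝ, p.1 = 1 ∨ p.1 = -1 → S.IsCrossing 0 p ∨ S.IsTangent 0 p

/-- The line integral `∫ g_z dx - f_z dy` along `γ` restricted to `[0, T]`. -/
noncomputable def lineInt (S : Sys) (z : Zone) (γ : ℝ → ℝ × ℝ) (T : ℝ) : ℝ :=
  ∫ t in (0 : ℝ)..T, ((S.g z).val (γ t) * deriv (fun s => (γ s).1) t -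
    (S.f z).val (γ t) * deriv (fun s => (γ s).2) t)

/-- The Poincaré map through three zones takes `(1, y)` to `(1, y')`: the orbit of the
`ε`-system from `(1, y)` passes through the right, central, left and central zones, in this
order, and arrives at `(1, y')`. -/
def Ret0 (S : Sys) (ε y y' : ℝ) : Prop :=
  ∃ y₁ y₂ y₃ : ℝ, S.Connects ε Zone.R (1, y) (1, y₁) ∧ S.Connects ε Zone.C (1, y₁) (-1, y₂) ∧
    S.Connects ε Zone.L (-1, y₂) (-1, y₃) ∧ S.Connects ε Zone.C (-1, y₃) (1, y')

/-- The return from `(1, y)` through the right and then the central zone to `(1, y')`. -/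
def Ret1 (S : Sys) (ε y y' : ℝ) : Prop :=
  ∃ y₁ : ℝ, S.Connects ε Zone.R (1, y) (1, y₁) ∧ S.Connects ε Zone.C (1, y₁) (1, y')

/-- The return from `(-1, y)` through the central and then the left zone to `(-1, y')`. -/
def Ret2 (S : Sys) (ε y y' : ℝ) : Prop :=
  ∃ y₁ : ℝ, S.Connects ε Zone.C (-1, y) (-1, y₁) ∧ S.Connects ε Zone.L (-1, y₁) (-1, y')

/-- `M` is the first order Melnikov function, on `J`, of the Poincaré map `ret` of the line
`x = x₀`, with starting points `(x₀, a h)` and with the displacement measured by `K`: for each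
`h ∈ J` the Poincaré map is defined at `(x₀, a h)` for all small `ε ≥ 0` and, with `P ε` the
ordinate of the image, `K (x₀, P ε) - K (x₀, a h) = ε M(h) + O(ε²)`. -/
def IsMelnikov (K : Ham) (x₀ : ℝ) (ret : ℝ → ℝ → ℝ → Prop) (J : Set ℝ) (a M : ℝ → ℝ) : Prop :=
  ∀ h ∈ J, ∃ ε₀ > 0, ∃ P : ℝ → ℝ, (∀ ε ∈ Ico 0 ε₀, ret ε (a h) (P ε)) ∧
    (fun ε : ℝ => K.val (x₀, P ε) - K.val (x₀, a h) - ε * M h)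
      =O[𝓝[≥] 0] (fun ε : ℝ => ε ^ 2)

end Sys

/-- A periodic annulus of the unperturbed system made of clockwise crossing periodic orbits
through three zones, parametrized by `h` in an open interval `J`. The orbit of `h` runs through
`A = (1, a h)`, `A₁ = (1, a₁ h)`, `A₂ = (-1, a₂ h)`, `A₃ = (-1, a₃ h)` and consists of the
arcs `γR` from `A` to `A₁`, `γB` from `A₁` to `A₂`, `γL` from `A₂` to `A₃` and `γC` from `A₃`
to `A`. -/
structure Annulus0 (S : Sys) where
  J : Set ℝ
  isOpen : IsOpen J
  interval : J.OrdConnected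
  nonempty : J.Nonempty
  (a a₁ a₂ a₃ : ℝ → ℝ)
  diff : DifferentiableOn ℝ a J
  inj : InjOn a J
  (γR γB γL γC : ℝ → ℝ → ℝ × ℝ)
  (TR TB TL TC : ℝ → ℝ)
  lt_right : ∀ h ∈ J, a₁ h < a h
  lt_left : ∀ h ∈ J, a₂ h < a₃ h
  cross : ∀ h ∈ J, S.IsCrossing 0 (1, a h)
  cross₁ : ∀ h ∈ J, S.IsCrossing 0 (1, a₁ h)
  cross₂ : ∀ h ∈ J, S.IsCrossing 0 (-1, a₂ h)
  cross₃ : ∀ h ∈ J, S.IsCrossing 0 (-1, a₃ h)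
  arcR : ∀ h ∈ J, S.IsArc 0 Zone.R (1, a h) (1, a₁ h) (γR h) (TR h)
  arcB : ∀ h ∈ J, S.IsArc 0 Zone.C (1, a₁ h) (-1, a₂ h) (γB h) (TB h)
  arcL : ∀ h ∈ J, S.IsArc 0 Zone.L (-1, a₂ h) (-1, a₃ h) (γL h) (TL h)
  arcC : ∀ h ∈ J, S.IsArc 0 Zone.C (-1, a₃ h) (1, a h) (γC h) (TC h)

/-- A periodic annulus of the unperturbed system made of clockwise crossing periodic orbits
through the right and central zones: the orbit of `h` consists of the arcs `γR` from
`B = (1, b h)` to `B₁ = (1, b₁ h)` and `γC` from `B₁` to `B`. -/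
structure Annulus1 (S : Sys) where
  J : Set ℝ
  isOpen : IsOpen J
  interval : J.OrdConnected
  nonempty : J.Nonempty
  (b b₁ : ℝ → ℝ)
  diff : DifferentiableOn ℝ b J
  inj : InjOn b J
  (γR γC : ℝ → ℝ → ℝ × ℝ)
  (TR TC : ℝ → ℝ)
  lt : ∀ h ∈ J, b₁ h < b h
  cross : ∀ h ∈ J, S.IsCrossing 0 (1, b h)
  cross₁ : ∀ h ∈ J, S.IsCrossing 0 (1, b₁ h)
  arcR : ∀ h ∈ J, S.IsArc 0 Zone.R (1, b h) (1, b₁ h) (γR h) (TR h)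
  arcC : ∀ h ∈ J, S.IsArc 0 Zone.C (1, b₁ h) (1, b h) (γC h) (TC h)

/-- A periodic annulus of the unperturbed system made of clockwise crossing periodic orbits
through the central and left zones: the orbit of `h` consists of the arcs `γC` from
`C = (-1, c h)` to `C₁ = (-1, c₁ h)` and `γL` from `C₁` to `C`. -/
structure Annulus2 (S : Sys) where
  J : Set ℝ
  isOpen : IsOpen J
  interval : J.OrdConnected
  nonempty : J.Nonempty
  (c c₁ : ℝ → ℝ)
  diff : DifferentiableOn ℝ c J
  inj : InjOn c J
  (γC γL : ℝ → ℝ → ℝ × ℝ)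
  (TC TL : ℝ → ℝ)
  lt : ∀ h ∈ J, c₁ h < c h
  cross : ∀ h ∈ J, S.IsCrossing 0 (-1, c h)
  cross₁ : ∀ h ∈ J, S.IsCrossing 0 (-1, c₁ h)
  arcC : ∀ h ∈ J, S.IsArc 0 Zone.C (-1, c h) (-1, c₁ h) (γC h) (TC h)
  arcL : ∀ h ∈ J, S.IsArc 0 Zone.L (-1, c₁ h) (-1, c h) (γL h) (TL h)

namespace Annulus0

variable {S : Sys}

/-- The periodic orbit `L⁰_h`. -/
def orbit (D : Annulus0 S) (h : ℝ) : Set (ℝ × ℝ) :=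
  D.γR h '' Icc 0 (D.TR h) ∪ D.γB h '' Icc 0 (D.TB h) ∪
    D.γL h '' Icc 0 (D.TL h) ∪ D.γC h '' Icc 0 (D.TC h)

/-- The explicit expression of `M₀`. -/
noncomputable def M (D : Annulus0 S) (h : ℝ) : ℝ :=
  let A : ℝ × ℝ := (1, D.a h)
  let A₁ : ℝ × ℝ := (1, D.a₁ h)
  let A₂ : ℝ × ℝ := (-1, D.a₂ h)
  let A₃ : ℝ × ℝ := (-1, D.a₃ h)
  let HL := S.H Zone.L
  let HC := S.H Zone.C
  let HR := S.H Zone.R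
  HR.dy A / HC.dy A * S.lineInt Zone.C (D.γC h) (D.TC h) +
  (HR.dy A * HC.dy A₃) / (HC.dy A * HL.dy A₃) * S.lineInt Zone.L (D.γL h) (D.TL h) +
  (HR.dy A * HC.dy A₃ * HL.dy A₂) / (HC.dy A * HL.dy A₃ * HC.dy A₂) *
    S.lineInt Zone.C (D.γB h) (D.TB h) +
  (HR.dy A * HC.dy A₃ * HL.dy A₂ * HC.dy A₁) / (HC.dy A * HL.dy A₃ * HC.dy A₂ * HR.dy A₁) *
    S.lineInt Zone.R (D.γR h) (D.TR h)

end Annulus0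

namespace Annulus1

variable {S : Sys}

/-- The periodic orbit `L¹_h`. -/
def orbit (D : Annulus1 S) (h : ℝ) : Set (ℝ × ℝ) :=
  D.γR h '' Icc 0 (D.TR h) ∪ D.γC h '' Icc 0 (D.TC h)

/-- The explicit expression of `M₁`. -/
noncomputable def M (D : Annulus1 S) (h : ℝ) : ℝ :=
  let B : ℝ × ℝ := (1, D.b h)
  let B₁ : ℝ × ℝ := (1, D.b₁ h)
  let HC := S.H Zone.C
  let HR := S.H Zone.R
  HR.dy B / HC.dy B * S.lineInt Zone.C (D.γC h) (D.TC h) +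
  (HR.dy B * HC.dy B₁) / (HC.dy B * HR.dy B₁) * S.lineInt Zone.R (D.γR h) (D.TR h)

end Annulus1

namespace Annulus2

variable {S : Sys}

/-- The periodic orbit `L²_h`. -/
def orbit (D : Annulus2 S) (h : ℝ) : Set (ℝ × ℝ) :=
  D.γC h '' Icc 0 (D.TC h) ∪ D.γL h '' Icc 0 (D.TL h)

/-- The explicit expression of `M₂`. -/
noncomputable def M (D : Annulus2 S) (h : ℝ) : ℝ :=
  let P : ℝ × ℝ := (-1, D.c h)
  let P₁ : ℝ × ℝ := (-1, D.c₁ h)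
  let HL := S.H Zone.L
  let HC := S.H Zone.C
  HC.dy P / HL.dy P * S.lineInt Zone.L (D.γL h) (D.TL h) +
  (HC.dy P * HL.dy P₁) / (HL.dy P * HC.dy P₁) * S.lineInt Zone.C (D.γC h) (D.TC h)

end Annulus2

end PWHam

namespace PWHam

/-! All three annuli consist of closed chains of k arcs (k = 4, 2, 2) joined at crossing points, so
one argument on a `Cycle` indexed by `ZMod k` covers them.

Melnikov formula. Each subsystem is affine, so its flow is a matrix exponential, smooth jointly in
ε, time and initial point. Since an arc meets the switching lines transversally at both ends, the
implicit function theorem gives a C² transition time, and nearby orbits still form arcs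
(`exists_transition`). Along a solution in zone z the energy H^z changes at the rate ε(f H_x + g
H_y), whose integral over the unperturbed arc is the line integral I of g dx − f dy. Differentiating
this balance at ε = 0 links the ε-derivatives v, v' of the ordinates at the two ends by H_y(end) v'
= I + H_y(start) v (`hasDerivAt_transition`). Iterating from v = 0 around the cycle gives the stated
sums, and C² regularity gives the O(ε²) remainder.

Limit cycles. Let P(ε, y) be the Poincaré map and m(y) its ε-derivative at ε = 0. The injective
continuous function a maps onto a neighbourhood of each of its values, so P(0, ·) is the identity
near a(h*), and M = H_y · (m ∘ a) near h*. A simple zero of M therefore yields a simple zero of m,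
which continues to a unique fixed point of P(ε, ·) for small ε > 0 (`exists_unique_zero_of_simple`).

It remains to see that every periodic orbit near the cycle comes from a fixed point. Crossing orbits
with vertices close to those of the cycle must follow its arcs in cyclic order; if such an orbit
makes several turns, its returns form a periodic sequence of the strictly increasing map P(ε, ·),
hence are constant (`Confined.exists_fixed`). Orbits in a single zone are excluded because every
orbit near the cycle leaves each closed zone at some time (`exists_nhd_no_oneZone`). -/

theorem hasDerivAt_comp_fst {E F : Type*} [NormedAddCommGroup E] [NormedSpace ℝ E]
    [NormedAddCommGroup F] [NormedSpace ℝ F] {u : ℝ → E × F} {u' : E × F} {t : ℝ}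
    (h : HasDerivAt u u' t) : HasDerivAt (fun s => (u s).1) u'.1 t :=
  (ContinuousLinearMap.fst ℝ E F).hasFDerivAt.comp_hasDerivAt t h

theorem hasDerivAt_comp_snd {E F : Type*} [NormedAddCommGroup E] [NormedSpace ℝ E]
    [NormedAddCommGroup F] [NormedSpace ℝ F] {u : ℝ → E × F} {u' : E × F} {t : ℝ}
    (h : HasDerivAt u u' t) : HasDerivAt (fun s => (u s).2) u'.2 t :=
  (ContinuousLinearMap.snd ℝ E F).hasFDerivAt.comp_hasDerivAt t h

namespace Sys

/-! ### The flow of a subsystem -/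

/-- The linear part of `field`, made homogeneous by a third coordinate. -/
noncomputable def gen (S : Sys) (ε : ℝ) (z : Zone) : (ℝ × ℝ × ℝ) →L[ℝ] (ℝ × ℝ × ℝ) :=
  let X : (ℝ × ℝ × ℝ) →L[ℝ] ℝ := ContinuousLinearMap.fst ℝ ℝ (ℝ × ℝ)
  let Y : (ℝ × ℝ × ℝ) →L[ℝ] ℝ :=
    (ContinuousLinearMap.fst ℝ ℝ ℝ).comp (ContinuousLinearMap.snd ℝ ℝ (ℝ × ℝ))
  let W : (ℝ × ℝ × ℝ) →L[ℝ] ℝ :=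
    (ContinuousLinearMap.snd ℝ ℝ ℝ).comp (ContinuousLinearMap.snd ℝ ℝ (ℝ × ℝ))
  ((S.H z).b • Y + (S.H z).a • X + (S.H z).α • W).prod
      (((S.H z).c • X - (S.H z).a • Y + (S.H z).β • W).prod 0) +
    ε • ((S.f z).c10 • X + (S.f z).c01 • Y + (S.f z).c00 • W).prod
      (((S.g z).c10 • X + (S.g z).c01 • Y + (S.g z).c00 • W).prod 0)

theorem gen_apply (S : Sys) (ε : ℝ) (z : Zone) (x y : ℝ) :
    S.gen ε z (x, y, 1) = ((S.field ε z (x, y)).1, (S.field ε z (x, y)).2, 0) := by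
  simp only [gen, field, Ham.dx, Ham.dy, Aff.val, Prod.mk.injEq, add_apply, smul_apply,
    sub_apply, zero_apply, ContinuousLinearMap.prod_apply, ContinuousLinearMap.comp_apply,
    ContinuousLinearMap.coe_fst', ContinuousLinearMap.coe_snd', smul_eq_mul, Prod.mk_add_mk,
    Prod.smul_mk]
  refine ⟨by ring, by ring, by ring⟩

theorem gen_apply_snd_snd (S : Sys) (ε : ℝ) (z : Zone) (v : ℝ × ℝ × ℝ) :
    (S.gen ε z v).2.2 = 0 := by
  simp [gen]

/-- The flow of the homogenized subsystem. -/
noncomputable def homFlow (S : Sys) (ε : ℝ) (z : Zone) (t : ℝ) (p : ℝ × ℝ) : ℝ × ℝ × ℝ :=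
  NormedSpace.exp (t • S.gen ε z) (p.1, p.2, 1)

/-- The flow of the subsystem of the zone `z`. -/
noncomputable def flow (S : Sys) (ε : ℝ) (z : Zone) (t : ℝ) (p : ℝ × ℝ) : ℝ × ℝ :=
  ((S.homFlow ε z t p).1, (S.homFlow ε z t p).2.1)

theorem hasDerivAt_homFlow (S : Sys) (ε : ℝ) (z : Zone) (t : ℝ) (p : ℝ × ℝ) :
    HasDerivAt (fun t => S.homFlow ε z t p) (S.gen ε z (S.homFlow ε z t p)) t :=
  (hasDerivAt_exp_smul_const' (𝕂 := ℝ) (S.gen ε z) t).clm_apply (hasDerivAt_const t _)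
    |>.congr_deriv (by simp [homFlow])

theorem homFlow_zero (S : Sys) (ε : ℝ) (z : Zone) (p : ℝ × ℝ) :
    S.homFlow ε z 0 p = (p.1, p.2, 1) := by
  simp [homFlow]

/-- The generator has zero last component, so the plane with third coordinate 1 is invariant; on it
the linear system is the affine field. -/
theorem homFlow_snd_snd (S : Sys) (ε : ℝ) (z : Zone) (t : ℝ) (p : ℝ × ℝ) :
    (S.homFlow ε z t p).2.2 = 1 := by
  have h : ∀ t, HasDerivAt (fun t => (S.homFlow ε z t p).2.2) 0 t := fun t => by
    have := hasDerivAt_comp_snd (hasDerivAt_comp_snd (S.hasDerivAt_homFlow ε z t p))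
    rwa [gen_apply_snd_snd] at this
  have := is_const_of_deriv_eq_zero (fun t => (h t).differentiableAt) (fun t => (h t).deriv) t 0
  simpa [homFlow_zero] using this

theorem flow_zero (S : Sys) (ε : ℝ) (z : Zone) (p : ℝ × ℝ) : S.flow ε z 0 p = p := by
  simp [flow, homFlow_zero]

theorem isSolution_flow (S : Sys) (ε : ℝ) (z : Zone) (p : ℝ × ℝ) :
    S.IsSolution ε z (fun t => S.flow ε z t p) := by
  intro t
  have h := S.hasDerivAt_homFlow ε z t p
  have e : S.homFlow ε z t p = ((S.flow ε z t p).1, (S.flow ε z t p).2, 1) := by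
    rw [← S.homFlow_snd_snd ε z t p]
    rfl
  rw [e, gen_apply] at h
  exact (hasDerivAt_comp_fst h).prodMk (hasDerivAt_comp_fst (hasDerivAt_comp_snd h))

theorem lipschitzWith_field (S : Sys) (ε : ℝ) (z : Zone) :
    ∃ K, LipschitzWith K (S.field ε z) := by
  let A : (ℝ × ℝ) →L[ℝ] (ℝ × ℝ × ℝ) := (ContinuousLinearMap.fst ℝ ℝ ℝ).prod
    ((ContinuousLinearMap.snd ℝ ℝ ℝ).prod 0)
  let B : (ℝ × ℝ × ℝ) →L[ℝ] (ℝ × ℝ) := (ContinuousLinearMap.fst ℝ ℝ (ℝ × ℝ)).prod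
    ((ContinuousLinearMap.fst ℝ ℝ ℝ).comp (ContinuousLinearMap.snd ℝ ℝ (ℝ × ℝ)))
  have h : S.field ε z = fun p => (B.comp ((S.gen ε z).comp A)) p + S.field ε z 0 := by
    funext p
    have e : S.gen ε z (A p) = S.gen ε z (p.1, p.2, 1) - S.gen ε z (0, 0, 1) := by
      rw [← map_sub]
      simp [A]
    simp only [ContinuousLinearMap.comp_apply, e, gen_apply]
    have e0 : S.field ε z (0, 0) = S.field ε z 0 := rfl
    ext <;> simp [B, e0]
  rw [h]
  exact ⟨_, (ContinuousLinearMap.lipschitz _).add (LipschitzWith.const _)⟩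

theorem IsSolution.eq_of_eq {S : Sys} {ε : ℝ} {z : Zone} {γ δ : ℝ → ℝ × ℝ}
    (hγ : S.IsSolution ε z γ) (hδ : S.IsSolution ε z δ) {t : ℝ} (h : γ t = δ t) : γ = δ := by
  obtain ⟨K, hK⟩ := S.lipschitzWith_field ε z
  exact ODE_solution_unique_univ (v := fun _ => S.field ε z) (s := fun _ => univ)
    (fun _ => hK.lipschitzOnWith) (fun t => ⟨hγ t, mem_univ _⟩) (fun t => ⟨hδ t, mem_univ _⟩) h

theorem IsSolution.eq_flow {S : Sys} {ε : ℝ} {z : Zone} {γ : ℝ → ℝ × ℝ}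
    (hγ : S.IsSolution ε z γ) : γ = fun t => S.flow ε z t (γ 0) :=
  hγ.eq_of_eq (S.isSolution_flow ε z (γ 0)) (t := 0) (S.flow_zero ε z _).symm

theorem IsSolution.shift {S : Sys} {ε : ℝ} {z : Zone} {γ : ℝ → ℝ × ℝ}
    (hγ : S.IsSolution ε z γ) (s : ℝ) : S.IsSolution ε z (fun t => γ (t + s)) :=
  fun t => (hγ (t + s)).comp_add_const t s

theorem IsSolution.flow_eq {S : Sys} {ε : ℝ} {z : Zone} {γ : ℝ → ℝ × ℝ}
    (hγ : S.IsSolution ε z γ) (t s : ℝ) : S.flow ε z t (γ s) = γ (t + s) := by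
  have := congrFun (hγ.shift s).eq_flow t
  simpa using this.symm

theorem IsSolution.continuous {S : Sys} {ε : ℝ} {z : Zone} {γ : ℝ → ℝ × ℝ}
    (hγ : S.IsSolution ε z γ) : Continuous γ :=
  continuous_iff_continuousAt.2 fun t => (hγ t).continuousAt

/-- Read off the formula: `gen` is affine in ε, the exponential is analytic, and evaluation is
bilinear. -/
theorem contDiff_flow (S : Sys) (z : Zone) {n : WithTop ℕ∞} :
    ContDiff ℝ n (fun q : ℝ × ℝ × (ℝ × ℝ) => S.flow q.1 z q.2.1 q.2.2) := by
  have hexp : ContDiff ℝ n (NormedSpace.exp : ((ℝ × ℝ × ℝ) →L[ℝ] (ℝ × ℝ × ℝ)) → _) :=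
    contDiff_iff_contDiffAt.2 fun x => (NormedSpace.exp_analytic (𝕂 := ℝ) x).contDiffAt
  have hgen : ContDiff ℝ n (fun ε => S.gen ε z) := by
    unfold gen
    fun_prop
  have h : ContDiff ℝ n (fun q : ℝ × ℝ × (ℝ × ℝ) => S.homFlow q.1 z q.2.1 q.2.2) := by
    have hg : ContDiff ℝ n (fun q : ℝ × ℝ × (ℝ × ℝ) => q.2.1 • S.gen q.1 z) :=
      (contDiff_fst.comp contDiff_snd).smul (hgen.comp contDiff_fst)
    have hp : ContDiff ℝ n (fun q : ℝ × ℝ × (ℝ × ℝ) => ((q.2.2.1, q.2.2.2, 1) : ℝ × ℝ × ℝ)) := by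
      fun_prop
    exact (hexp.comp hg).clm_apply hp
  exact h.fst.prodMk h.snd.fst

theorem continuous_flow (S : Sys) (z : Zone) :
    Continuous (fun q : ℝ × ℝ × (ℝ × ℝ) => S.flow q.1 z q.2.1 q.2.2) :=
  (S.contDiff_flow z (n := 0)).continuous

theorem continuous_field (S : Sys) (z : Zone) :
    Continuous (fun q : ℝ × (ℝ × ℝ) => S.field q.1 z q.2) := by
  unfold field Ham.dx Ham.dy Aff.val
  fun_prop

theorem hasDerivAt_flow_fst (S : Sys) (ε : ℝ) (z : Zone) (t : ℝ) (p : ℝ × ℝ) :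
    HasDerivAt (fun t => (S.flow ε z t p).1) (S.field ε z (S.flow ε z t p)).1 t :=
  hasDerivAt_comp_fst (S.isSolution_flow ε z p t)

end Sys

end PWHam

namespace PWHam

/-! ### Zones and their sides -/

/-- The line of abscissa `x` bounds the zone `z`, which lies on the side of the line given by the
sign `σ`. -/
def Side (z : Zone) (x σ : ℝ) : Prop :=
  (z = Zone.R ∧ x = 1 ∧ σ = 1) ∨ (z = Zone.C ∧ x = 1 ∧ σ = -1) ∨
    (z = Zone.C ∧ x = -1 ∧ σ = 1) ∨ (z = Zone.L ∧ x = -1 ∧ σ = -1)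

theorem isOpen_region (z : Zone) : IsOpen z.region := by
  cases z
  · exact isOpen_lt continuous_fst continuous_const
  · exact (isOpen_lt continuous_const continuous_fst).inter
      (isOpen_lt continuous_fst continuous_const)
  · exact isOpen_lt continuous_const continuous_fst

theorem notMem_region_of_line {p : ℝ × ℝ} (hp : p.1 = 1 ∨ p.1 = -1) (z : Zone) :
    p ∉ z.region := by
  cases z <;> rcases hp with hp | hp <;> simp only [Zone.region, mem_ofPred_eq] <;>
    rw [hp] <;> norm_num

theorem Side.pos_of_mem {z : Zone} {x σ : ℝ} (h : Side z x σ) {p : ℝ × ℝ} (hp : p ∈ z.region) :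
    0 < σ * (p.1 - x) := by
  rcases h with ⟨rfl, rfl, rfl⟩ | ⟨rfl, rfl, rfl⟩ | ⟨rfl, rfl, rfl⟩ | ⟨rfl, rfl, rfl⟩ <;>
    simp only [Zone.region, mem_ofPred_eq] at hp <;> linarith

theorem Side.nonneg_of_mem_closure {z : Zone} {x σ : ℝ} (h : Side z x σ) {p : ℝ × ℝ}
    (hp : p ∈ closure z.region) : 0 ≤ σ * (p.1 - x) :=
  closure_minimal (t := {p : ℝ × ℝ | 0 ≤ σ * (p.1 - x)}) (fun _ hq => (h.pos_of_mem hq).le)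
    (isClosed_le (by fun_prop) (by fun_prop)) hp

theorem Side.eventually_mem {z : Zone} {x σ : ℝ} (h : Side z x σ) :
    ∀ᶠ s in 𝓝 x, 0 < σ * (s - x) → ∀ y, (s, y) ∈ z.region := by
  -- The central zone has width 2, so within distance 2 of one of its lines the other is not
  -- reached.
  have h1 : ∀ᶠ s in 𝓝 x, s < x + 2 := eventually_lt_nhds (by linarith)
  have h2 : ∀ᶠ s in 𝓝 x, x - 2 < s := eventually_gt_nhds (by linarith)
  filter_upwards [h1, h2] with s h1 h2 h3 y
  rcases h with ⟨rfl, rfl, rfl⟩ | ⟨rfl, rfl, rfl⟩ | ⟨rfl, rfl, rfl⟩ | ⟨rfl, rfl, rfl⟩ <;>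
    simp only [Zone.region, mem_ofPred_eq] <;> first | linarith | constructor <;> linarith

theorem closure_region_subset (z : Zone) : closure z.region ⊆
    match z with
    | Zone.L => {p | p.1 ≤ -1}
    | Zone.C => {p | -1 ≤ p.1 ∧ p.1 ≤ 1}
    | Zone.R => {p | 1 ≤ p.1} := by
  cases z
  · exact closure_minimal (fun p (hp : p.1 < -1) => hp.le)
      (isClosed_le continuous_fst continuous_const)
  · exact closure_minimal (fun p (hp : -1 < p.1 ∧ p.1 < 1) => ⟨hp.1.le, hp.2.le⟩)
      ((isClosed_le continuous_const continuous_fst).inter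
        (isClosed_le continuous_fst continuous_const))
  · exact closure_minimal (fun p (hp : 1 < p.1) => hp.le)
      (isClosed_le continuous_const continuous_fst)

theorem exists_side {z : Zone} {p : ℝ × ℝ} (hp : p.1 = 1 ∨ p.1 = -1)
    (hz : p ∈ closure z.region) : ∃ σ, Side z p.1 σ := by
  have h := closure_region_subset z hz
  cases z <;> rcases hp with hp | hp <;> simp only [mem_ofPred_eq, hp] at h <;>
    first | (exfalso; linarith) | simp [Side, hp]

theorem eq_of_mem_region_of_mem_closure {z w : Zone} {p : ℝ × ℝ} (hz : p ∈ z.region)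
    (hw : p ∈ closure w.region) : w = z := by
  have h := closure_region_subset w hw
  cases z <;> cases w <;> simp only [Zone.region, mem_ofPred_eq] at h hz <;>
    first | rfl | (exfalso; linarith)

namespace Sys

variable {S : Sys} {ε : ℝ} {z : Zone} {p q : ℝ × ℝ} {γ : ℝ → ℝ × ℝ} {T : ℝ}

/-! ### Crossing points and arcs -/

theorem IsCrossing.line (h : S.IsCrossing ε p) : p.1 = 1 ∨ p.1 = -1 :=
  h.imp And.left And.left

/-- At a crossing point, only one zone lies ahead. -/
theorem IsCrossing.zone_unique (h : S.IsCrossing ε p) {w : Zone} {σ ρ : ℝ}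
    (hz : Side z p.1 σ) (hw : Side w p.1 ρ) (hz' : 0 ≤ σ * (S.field ε z p).1)
    (hw' : 0 ≤ ρ * (S.field ε w p).1) : w = z := by
  rcases h with ⟨hp, h⟩ | ⟨hp, h⟩ <;> rw [hp] at hz hw <;>
  rcases hz with ⟨rfl, hz, rfl⟩ | ⟨rfl, hz, rfl⟩ | ⟨rfl, hz, rfl⟩ | ⟨rfl, hz, rfl⟩ <;>
  rcases hw with ⟨rfl, hw, rfl⟩ | ⟨rfl, hw, rfl⟩ | ⟨rfl, hw, rfl⟩ | ⟨rfl, hw, rfl⟩ <;>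
    first
    | rfl
    | (exfalso; norm_num at hz hw; done)
    | (exfalso; nlinarith)

theorem IsCrossing.field_ne_zero (h : S.IsCrossing ε p) {σ : ℝ} (hz : Side z p.1 σ) :
    (S.field ε z p).1 ≠ 0 := by
  intro h0
  rcases h with ⟨hp, h⟩ | ⟨hp, h⟩ <;> rw [hp] at hz <;>
  rcases hz with ⟨rfl, hz, rfl⟩ | ⟨rfl, hz, rfl⟩ | ⟨rfl, hz, rfl⟩ | ⟨rfl, hz, rfl⟩ <;>
    first
    | (norm_num at hz; done)
    | (rw [h0] at h; simp at h)

theorem IsArc.mem_closure (h : S.IsArc ε z p q γ T) {t : ℝ} (ht : t ∈ Icc 0 T) :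
    γ t ∈ closure z.region := by
  have h1 : t ∈ closure (Ioo 0 T) := by rwa [closure_Ioo h.pos.ne]
  exact closure_mono (image_subset_iff.2 h.inside)
    (image_closure_subset_closure_image h.sol.continuous (mem_image_of_mem γ h1))

/-- Just after the start the arc is on the side σ of the line, so the right difference quotients of
σx are positive. In the limit only a weak inequality survives; crossing makes it strict. `IsArc.end`
uses left quotients in the same way. -/
theorem IsArc.start (h : S.IsArc ε z p q γ T) (hp : p.1 = 1 ∨ p.1 = -1) :
    ∃ σ, Side z p.1 σ ∧ 0 ≤ σ * (S.field ε z p).1 := by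
  have hm := h.mem_closure (left_mem_Icc.2 h.pos.le)
  rw [h.init] at hm
  obtain ⟨σ, hσ⟩ := exists_side hp hm
  refine ⟨σ, hσ, ?_⟩
  have hd : HasDerivAt (fun t => σ * (γ t).1) (σ * (S.field ε z p).1) 0 := by
    have := (hasDerivAt_comp_fst (h.sol 0)).const_mul σ
    rwa [h.init] at this
  refine ge_of_tendsto ((hasDerivAt_iff_tendsto_slope.1 hd).mono_left
    (nhdsWithin_mono 0 (s := Ioi 0) fun t ht => (mem_Ioi.1 ht).ne')) ?_
  filter_upwards [Ioo_mem_nhdsGT h.pos] with t ht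
  have := hσ.pos_of_mem (h.inside t ht)
  rw [slope_def_field, h.init]
  exact div_nonneg (by linarith) (by linarith [ht.1])

theorem IsArc.end (h : S.IsArc ε z p q γ T) (hq : q.1 = 1 ∨ q.1 = -1) :
    ∃ σ, Side z q.1 σ ∧ σ * (S.field ε z q).1 ≤ 0 := by
  have hm := h.mem_closure (right_mem_Icc.2 h.pos.le)
  rw [h.term] at hm
  obtain ⟨σ, hσ⟩ := exists_side hq hm
  refine ⟨σ, hσ, ?_⟩
  have hd : HasDerivAt (fun t => σ * (γ t).1) (σ * (S.field ε z q).1) T := by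
    have := (hasDerivAt_comp_fst (h.sol T)).const_mul σ
    rwa [h.term] at this
  refine le_of_tendsto ((hasDerivAt_iff_tendsto_slope.1 hd).mono_left
    (nhdsWithin_mono T (s := Iio T) fun t ht => (mem_Iio.1 ht).ne)) ?_
  filter_upwards [Ioo_mem_nhdsLT h.pos] with t ht
  have := hσ.pos_of_mem (h.inside t ht)
  rw [slope_def_field, h.term]
  exact div_nonpos_of_nonneg_of_nonpos (by linarith) (by linarith [ht.2])

theorem IsArc.eq_flow (h : S.IsArc ε z p q γ T) : γ = fun t => S.flow ε z t p := by
  rw [← h.init]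
  exact h.sol.eq_flow

theorem IsArc.time_le {q' : ℝ × ℝ} {γ' : ℝ → ℝ × ℝ} {T' : ℝ} (h : S.IsArc ε z p q γ T)
    (h' : S.IsArc ε z p q' γ' T') (hq' : q'.1 = 1 ∨ q'.1 = -1) : T ≤ T' := by
  by_contra! hlt
  refine notMem_region_of_line hq' z ?_
  rw [← h'.term, h'.eq_flow, ← h.eq_flow]
  exact h.inside T' ⟨h'.pos, hlt⟩

/-- An arc between switching lines is determined by its zone and its starting point. -/
theorem IsArc.unique {q' : ℝ × ℝ} {γ' : ℝ → ℝ × ℝ} {T' : ℝ} (h : S.IsArc ε z p q γ T)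
    (h' : S.IsArc ε z p q' γ' T') (hq : q.1 = 1 ∨ q.1 = -1) (hq' : q'.1 = 1 ∨ q'.1 = -1) :
    γ = γ' ∧ T = T' ∧ q = q' := by
  have h1 : γ = γ' := by rw [h.eq_flow, h'.eq_flow]
  have h2 : T = T' := (h.time_le h' hq').antisymm (h'.time_le h hq)
  exact ⟨h1, h2, by rw [← h.term, ← h'.term, h1, h2]⟩

/-- An orbit transversal to a switching line leaves every closed zone there. -/
theorem exists_flow_notMem_closure (hp : p.1 = 1 ∨ p.1 = -1)
    (hne : ∀ σ, Side z p.1 σ → (S.field ε z p).1 ≠ 0) :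
    ∃ t, S.flow ε z t p ∉ closure z.region := by
  by_contra! hall
  have h0 := hall 0
  rw [S.flow_zero] at h0
  obtain ⟨σ, hσ⟩ := exists_side hp h0
  have hd : HasDerivAt (fun t => σ * ((S.flow ε z t p).1 - p.1)) (σ * (S.field ε z p).1) 0 := by
    have := ((S.hasDerivAt_flow_fst ε z 0 p).sub_const p.1).const_mul σ
    rwa [S.flow_zero] at this
  -- The orbit is assumed to stay in the closed zone for past and future times, so its distance to
  -- the line has a two-sided minimum at time 0, against transversality.
  have hmin : IsLocalMin (fun t => σ * ((S.flow ε z t p).1 - p.1)) 0 :=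
    Eventually.of_forall fun t => by
      simpa [S.flow_zero] using hσ.nonneg_of_mem_closure (hall t)
  have h1 := hmin.hasDerivAt_eq_zero hd
  rcases mul_eq_zero.1 h1 with h1 | h1
  · rcases hσ with ⟨-, -, h⟩ | ⟨-, -, h⟩ | ⟨-, -, h⟩ | ⟨-, -, h⟩ <;> rw [h] at h1 <;> norm_num at h1
  · exact hne σ hσ h1

end Sys

/-! ### The transition map along an arc -/

/-- Positivity of the derivative holds on a product neighbourhood, so a single time interval of
monotonicity serves all nearby parameters. -/
theorem eventually_lt_of_deriv_pos {X : Type*} [TopologicalSpace X] {u u' : X → ℝ → ℝ}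
    (hu : ∀ q t, HasDerivAt (u q) (u' q t) t) {q₀ : X} {t₀ : ℝ}
    (hc : ContinuousAt (fun w : X × ℝ => u' w.1 w.2) (q₀, t₀)) (hpos : 0 < u' q₀ t₀) :
    ∀ᶠ w : X × ℝ × ℝ in 𝓝 (q₀, t₀, t₀), w.2.1 < w.2.2 → u w.1 w.2.1 < u w.1 w.2.2 := by
  have h1 : ∀ᶠ w : X × ℝ in 𝓝 q₀ ×ˢ 𝓝 t₀, 0 < u' w.1 w.2 := by
    rw [← nhds_prod_eq]
    exact hc.eventually (eventually_gt_nhds hpos)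
  obtain ⟨pa, ha, pb, hb, hab⟩ := eventually_prod_iff.1 h1
  obtain ⟨r, hr, hball⟩ := Metric.eventually_nhds_iff_ball.1 hb
  have hbr := Metric.ball_mem_nhds t₀ hr
  rw [nhds_prod_eq, nhds_prod_eq]
  filter_upwards [ha.prod_mk (prod_mem_prod hbr hbr)] with w hw hlt
  refine strictMonoOn_of_deriv_pos (convex_ball t₀ r)
    (fun t _ => (hu w.1 t).continuousAt.continuousWithinAt) (fun t ht => ?_) hw.2.1 hw.2.2 hlt
  rw [(hu w.1 t).deriv]
  exact hab hw.1 (hball t (interior_subset ht))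

theorem isInvertible_of_apply_one_ne_zero (L : ℝ →L[ℝ] ℝ) (h : L 1 ≠ 0) : L.IsInvertible := by
  refine ⟨ContinuousLinearEquiv.unitsEquivAut ℝ (Units.mk0 (L 1) h), ?_⟩
  ext
  simp

namespace Sys

variable {S : Sys} {z : Zone} {x₀ y₀ x₁ y₁ : ℝ} {γ : ℝ → ℝ × ℝ} {T : ℝ}

/-- Transversality at the end point lets the implicit function theorem solve for the arrival time.
That the orbit stays inside the zone before arrival follows from compactness away from the end
points, and from transversality near them, where openness of the zone is of no help. -/
theorem exists_transition (h : S.IsArc 0 z (x₀, y₀) (x₁, y₁) γ T) (hx₀ : x₀ = 1 ∨ x₀ = -1)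
    (hx₁ : x₁ = 1 ∨ x₁ = -1) (h₀ : (S.field 0 z (x₀, y₀)).1 ≠ 0)
    (h₁ : (S.field 0 z (x₁, y₁)).1 ≠ 0) :
    ∃ τ : ℝ × ℝ → ℝ, τ (0, y₀) = T ∧ ContDiffAt ℝ 2 τ (0, y₀) ∧
      ∀ᶠ q : ℝ × ℝ in 𝓝 (0, y₀), S.IsArc q.1 z (x₀, q.2)
        (x₁, (S.flow q.1 z (τ q) (x₀, q.2)).2) (fun t => S.flow q.1 z t (x₀, q.2)) (τ q) := by
  have hγ := h.eq_flow
  have hγ' : ∀ t, S.flow 0 z t (x₀, y₀) = γ t := fun t => by rw [hγ]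
  let f : (ℝ × ℝ) × ℝ → ℝ := fun w => (S.flow w.1.1 z w.2 (x₀, w.1.2)).1
  have hf : ContDiff ℝ 2 f := by
    have : ContDiff ℝ 2 (fun w : (ℝ × ℝ) × ℝ => (w.1.1, w.2, (x₀, w.1.2))) := by fun_prop
    exact ((S.contDiff_flow z).comp this).fst
  have hfu : f ((0, y₀), T) = x₁ := by simp [f, hγ', h.term]
  -- The time derivative of the first coordinate at arrival is the first component of the field
  -- there.
  have hinv : (fderiv ℝ f ((0, y₀), T) ∘L .inr ℝ (ℝ × ℝ) ℝ).IsInvertible := by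
    apply isInvertible_of_apply_one_ne_zero
    have hd : HasDerivAt (fun t : ℝ => f ((0, y₀), t)) (fderiv ℝ f ((0, y₀), T) (0, 1)) T :=
      (hf.differentiable (by norm_num) _).hasFDerivAt.comp_hasDerivAt T
        ((hasDerivAt_const T (0, y₀)).prodMk (hasDerivAt_id T))
    have hd' := S.hasDerivAt_flow_fst 0 z T (x₀, y₀)
    rw [hγ', h.term] at hd'
    simpa [hd.unique hd'] using h₁
  let τ := (hf.contDiffAt (x := ((0, y₀), T))).implicitFunction (by norm_num) hinv
  have hτ0 : τ (0, y₀) = T :=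
    (hf.contDiffAt (x := ((0, y₀), T))).implicitFunction_apply_self (by norm_num) hinv
  have hτ : ContDiffAt ℝ 2 τ (0, y₀) :=
    (hf.contDiffAt (x := ((0, y₀), T))).contDiffAt_implicitFunction (by norm_num) hinv
  have hτe : ∀ᶠ q in 𝓝 (0, y₀), f (q, τ q) = x₁ := by
    rw [← hfu]
    exact (hf.contDiffAt (x := ((0, y₀), T))).eventually_apply_implicitFunction (by norm_num) hinv
  refine ⟨τ, hτ0, hτ, ?_⟩
  have hτpos : ∀ᶠ q in 𝓝 (0, y₀), 0 < τ q :=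
    hτ.continuousAt.eventually (eventually_gt_nhds (by rw [hτ0]; exact h.pos))
  have hu : ∀ (σ : ℝ) (q : ℝ × ℝ) t, HasDerivAt (fun t => σ * f (q, t))
      (σ * (S.field q.1 z (S.flow q.1 z t (x₀, q.2))).1) t := fun σ q t =>
    (S.hasDerivAt_flow_fst q.1 z t (x₀, q.2)).const_mul σ
  have hflow : Continuous fun w : (ℝ × ℝ) × ℝ => S.flow w.1.1 z w.2 (x₀, w.1.2) :=
    (S.continuous_flow z).comp (f := fun w : (ℝ × ℝ) × ℝ => (w.1.1, w.2, (x₀, w.1.2)))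
      (by fun_prop)
  have hcu : ∀ σ : ℝ, Continuous fun w : (ℝ × ℝ) × ℝ =>
      σ * (S.field w.1.1 z (S.flow w.1.1 z w.2 (x₀, w.1.2))).1 := fun σ =>
    continuous_const.mul (continuous_fst.comp
      ((S.continuous_field z).comp ((by fun_prop : Continuous fun w : (ℝ × ℝ) × ℝ => w.1.1).prodMk
        hflow)))
  have hτs : ∀ s : ℝ, ContinuousAt (fun w : (ℝ × ℝ) × ℝ => τ w.1) ((0, y₀), s) := fun s =>
    ContinuousAt.comp (f := Prod.fst) hτ.continuousAt continuousAt_fst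
  have hflows : ∀ s : ℝ, ContinuousAt
      (fun w : (ℝ × ℝ) × ℝ => S.flow w.1.1 z (w.2 * τ w.1) (x₀, w.1.2)) ((0, y₀), s) := fun s =>
    ContinuousAt.comp (f := fun w : (ℝ × ℝ) × ℝ => (w.1, w.2 * τ w.1))
      hflow.continuousAt (continuousAt_fst.prodMk (continuousAt_snd.mul (hτs s)))
  -- Dividing time by τ puts all arcs on the compact interval [0, 1]. Membership is claimed only for
  -- 0 < s < 1, but the local statements are needed at 0 and 1 as well.
  have hin : ∀ᶠ q in 𝓝 (0, y₀), ∀ s ∈ Icc (0 : ℝ) 1, s ∈ Ioo (0 : ℝ) 1 →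
      S.flow q.1 z (s * τ q) (x₀, q.2) ∈ z.region := by
    refine isCompact_Icc.eventually_forall_of_forall_eventually fun s hs => ?_
    rcases eq_or_lt_of_le hs.1 with rfl | hs0
    · obtain ⟨σ, hσ, hσ'⟩ := h.start hx₀
      have hpos : 0 < σ * (S.field 0 z (S.flow 0 z 0 (x₀, y₀))).1 := by
        rw [S.flow_zero]
        refine lt_of_le_of_ne hσ' (Ne.symm (mul_ne_zero ?_ h₀))
        rcases hσ with ⟨-, -, h⟩ | ⟨-, -, h⟩ | ⟨-, -, h⟩ | ⟨-, -, h⟩ <;> rw [h] <;> norm_num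
      have h1 := eventually_lt_of_deriv_pos (hu σ) (q₀ := (0, y₀)) (t₀ := 0)
        (hcu σ).continuousAt hpos
      have h2 : Tendsto (fun w : (ℝ × ℝ) × ℝ => (w.1, (0 : ℝ), w.2 * τ w.1))
          (𝓝 ((0, y₀), 0)) (𝓝 ((0, y₀), 0, 0)) := by
        have : ContinuousAt (fun w : (ℝ × ℝ) × ℝ => (w.1, (0 : ℝ), w.2 * τ w.1)) ((0, y₀), 0) :=
          continuousAt_fst.prodMk (continuousAt_const.prodMk (continuousAt_snd.mul (hτs 0)))
        simpa [ContinuousAt] using this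
      have h3 : Tendsto (fun w : (ℝ × ℝ) × ℝ => (S.flow w.1.1 z (w.2 * τ w.1) (x₀, w.1.2)).1)
          (𝓝 ((0, y₀), 0)) (𝓝 x₀) := by
        have := (hflows 0).fst
        simpa [ContinuousAt, S.flow_zero] using this
      filter_upwards [h2.eventually h1, h3.eventually hσ.eventually_mem,
        continuousAt_fst.eventually hτpos] with w h1 h3 hpos hw
      refine h3 ?_ _
      have := h1 (mul_pos hw.1 hpos)
      simp only [f, S.flow_zero] at this
      linarith
    rcases eq_or_lt_of_le hs.2 with rfl | hs1
    · obtain ⟨σ, hσ, hσ'⟩ := h.end hx₁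
      have hpos : 0 < -σ * (S.field 0 z (S.flow 0 z T (x₀, y₀))).1 := by
        rw [hγ', h.term]
        refine lt_of_le_of_ne (by linarith) (Ne.symm (mul_ne_zero ?_ h₁))
        rcases hσ with ⟨-, -, h⟩ | ⟨-, -, h⟩ | ⟨-, -, h⟩ | ⟨-, -, h⟩ <;> rw [h] <;> norm_num
      have h1 := eventually_lt_of_deriv_pos (hu (-σ)) (q₀ := (0, y₀)) (t₀ := T)
        (hcu (-σ)).continuousAt hpos
      have h2 : Tendsto (fun w : (ℝ × ℝ) × ℝ => (w.1, w.2 * τ w.1, τ w.1))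
          (𝓝 ((0, y₀), 1)) (𝓝 ((0, y₀), T, T)) := by
        have : ContinuousAt (fun w : (ℝ × ℝ) × ℝ => (w.1, w.2 * τ w.1, τ w.1)) ((0, y₀), 1) :=
          continuousAt_fst.prodMk ((continuousAt_snd.mul (hτs 1)).prodMk (hτs 1))
        simpa [ContinuousAt, hτ0] using this
      have h3 : Tendsto (fun w : (ℝ × ℝ) × ℝ => (S.flow w.1.1 z (w.2 * τ w.1) (x₀, w.1.2)).1)
          (𝓝 ((0, y₀), 1)) (𝓝 x₁) := by
        have := (hflows 1).fst
        simpa [ContinuousAt, hτ0, hγ', h.term] using this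
      filter_upwards [h2.eventually h1, h3.eventually hσ.eventually_mem,
        continuousAt_fst.eventually hτpos, continuousAt_fst.eventually hτe] with w h1 h3 hpos he hw
      refine h3 ?_ _
      have := h1 (by nlinarith [hw.2])
      simp only [he] at this
      simp only [f] at this
      linarith
    · have h1 : S.flow 0 z (s * τ (0, y₀)) (x₀, y₀) ∈ z.region := by
        rw [hτ0, hγ']
        exact h.inside _ ⟨mul_pos hs0 h.pos, by nlinarith [h.pos]⟩
      filter_upwards [(hflows s).eventually ((isOpen_region z).mem_nhds h1)] with w hw _ using hw
  filter_upwards [hin, hτpos, hτe] with q hq hpos he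
  refine ⟨hpos, S.isSolution_flow _ _ _, S.flow_zero _ _ _, Prod.ext he rfl, fun t ht => ?_⟩
  have h1 : t / τ q ∈ Ioo (0 : ℝ) 1 := ⟨div_pos ht.1 hpos, (div_lt_one hpos).2 ht.2⟩
  have := hq _ (Ioo_subset_Icc_self h1) h1
  rwa [div_mul_cancel₀ _ hpos.ne'] at this

/-- Arcs depend continuously on the parameter and on the starting point. -/
theorem eventually_flow_image_subset (S : Sys) (z : Zone) {x₀ y₀ : ℝ} {τ : ℝ × ℝ → ℝ}
    (hτ : ContinuousAt τ (0, y₀)) (hpos : ∀ᶠ q in 𝓝 (0, y₀), 0 < τ q) {U : Set (ℝ × ℝ)}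
    (hU : IsOpen U) (hsub : (fun t => S.flow 0 z t (x₀, y₀)) '' Icc 0 (τ (0, y₀)) ⊆ U) :
    ∀ᶠ q : ℝ × ℝ in 𝓝 (0, y₀), (fun t => S.flow q.1 z t (x₀, q.2)) '' Icc 0 (τ q) ⊆ U := by
  have hflow : Continuous fun w : (ℝ × ℝ) × ℝ => S.flow w.1.1 z w.2 (x₀, w.1.2) :=
    (S.continuous_flow z).comp (f := fun w : (ℝ × ℝ) × ℝ => (w.1.1, w.2, (x₀, w.1.2)))
      (by fun_prop)
  have hflows : ∀ s : ℝ, ContinuousAt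
      (fun w : (ℝ × ℝ) × ℝ => S.flow w.1.1 z (w.2 * τ w.1) (x₀, w.1.2)) ((0, y₀), s) := fun s =>
    ContinuousAt.comp (f := fun w : (ℝ × ℝ) × ℝ => (w.1, w.2 * τ w.1)) hflow.continuousAt
      (continuousAt_fst.prodMk (continuousAt_snd.mul
        (ContinuousAt.comp (f := Prod.fst) hτ continuousAt_fst)))
  have hpos0 := hpos.self_of_nhds
  have hin : ∀ᶠ q in 𝓝 (0, y₀), ∀ s ∈ Icc (0 : ℝ) 1, S.flow q.1 z (s * τ q) (x₀, q.2) ∈ U := by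
    refine isCompact_Icc.eventually_forall_of_forall_eventually fun s hs => ?_
    refine (hflows s).eventually (hU.mem_nhds (hsub ⟨_, ⟨?_, ?_⟩, rfl⟩))
    · exact mul_nonneg hs.1 hpos0.le
    · exact mul_le_of_le_one_left hpos0.le hs.2
  filter_upwards [hin, hpos] with q hq hpos
  rintro _ ⟨t, ht, rfl⟩
  have := hq (t / τ q) ⟨div_nonneg ht.1 hpos.le, (div_le_one hpos).2 ht.2⟩
  rwa [div_mul_cancel₀ _ hpos.ne'] at this

end Sys

end PWHam

namespace PWHam

/-! ### Energy balance along an arc -/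

theorem Ham.hasDerivAt_val_comp (H : Ham) {γ : ℝ → ℝ × ℝ} {γ' : ℝ × ℝ} {t : ℝ}
    (h : HasDerivAt γ γ' t) :
    HasDerivAt (fun s => H.val (γ s)) (H.dx (γ t) * γ'.1 + H.dy (γ t) * γ'.2) t := by
  have hx := hasDerivAt_comp_fst h
  have hy := hasDerivAt_comp_snd h
  have h := (((((hy.pow 2).const_mul (H.b / 2)).sub ((hx.pow 2).const_mul (H.c / 2))).add
    ((hx.const_mul H.a).mul hy)).add (hy.const_mul H.α)).sub (hx.const_mul H.β)
  refine h.congr_deriv ?_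
  simp only [dx, dy]
  push_cast
  ring

/-- Away from 0 the difference quotient is W itself, so continuity of W suffices; W will be the
energy integral, whose limits and integrand depend on ε. -/
theorem hasDerivAt_mul_of_continuousAt {W : ℝ → ℝ} (hW : ContinuousAt W 0) :
    HasDerivAt (fun ε => ε * W ε) (W 0) 0 := by
  rw [hasDerivAt_iff_tendsto_slope]
  refine (hW.tendsto.mono_left nhdsWithin_le_nhds).congr' ?_
  filter_upwards [self_mem_nhdsWithin] with ε hε
  rw [slope_def_field]
  have : ε ≠ 0 := hε
  field_simp
  simp

namespace Sys

/-- The rate of change of the energy of a zone, divided by `ε`. -/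
def power (S : Sys) (z : Zone) (p : ℝ × ℝ) : ℝ :=
  (S.f z).val p * (S.H z).dx p + (S.g z).val p * (S.H z).dy p

theorem continuous_power (S : Sys) (z : Zone) : Continuous (S.power z) := by
  unfold power Ham.dx Ham.dy Aff.val
  fun_prop

/-- The Hamiltonian part of the field is tangent to the level curves and drops out. -/
theorem IsSolution.hasDerivAt_energy {S : Sys} {ε : ℝ} {z : Zone} {γ : ℝ → ℝ × ℝ}
    (h : S.IsSolution ε z γ) (t : ℝ) :
    HasDerivAt (fun s => (S.H z).val (γ s)) (ε * S.power z (γ t)) t := by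
  refine ((S.H z).hasDerivAt_val_comp (h t)).congr_deriv ?_
  simp only [field, power]
  ring

theorem IsSolution.energy_sub {S : Sys} {ε : ℝ} {z : Zone} {γ : ℝ → ℝ × ℝ}
    (h : S.IsSolution ε z γ) (T : ℝ) :
    (S.H z).val (γ T) - (S.H z).val (γ 0) = ε * ∫ t in (0 : ℝ)..T, S.power z (γ t) := by
  rw [← intervalIntegral.integral_const_mul]
  refine (intervalIntegral.integral_eq_sub_of_hasDerivAt (fun t _ => h.hasDerivAt_energy t)
    (Continuous.intervalIntegrable ?_ _ _)).symm
  exact continuous_const.mul ((S.continuous_power z).comp h.continuous)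

/-- On an unperturbed orbit dx = H_y dt and dy = −H_x dt. -/
theorem IsSolution.lineInt_eq {S : Sys} {z : Zone} {γ : ℝ → ℝ × ℝ}
    (h : S.IsSolution 0 z γ) (T : ℝ) :
    S.lineInt z γ T = ∫ t in (0 : ℝ)..T, S.power z (γ t) := by
  unfold lineInt
  congr 1
  funext t
  rw [(hasDerivAt_comp_fst (h t)).deriv, (hasDerivAt_comp_snd (h t)).deriv]
  simp only [field, power]
  ring

theorem field_zero_fst (S : Sys) (z : Zone) (p : ℝ × ℝ) : (S.field 0 z p).1 = (S.H z).dy p := by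
  simp [field]

variable {S : Sys} {z : Zone} {x₀ y₀ x₁ y₁ : ℝ} {γ : ℝ → ℝ × ℝ} {T : ℝ}

/-- The first order variation of the end point of an arc. -/
theorem hasDerivAt_transition (h : S.IsArc 0 z (x₀, y₀) (x₁, y₁) γ T)
    (h₁ : (S.H z).dy (x₁, y₁) ≠ 0) {τ : ℝ × ℝ → ℝ}
    (hτ0 : τ (0, y₀) = T) (hτ : ContDiffAt ℝ 2 τ (0, y₀))
    (harc : ∀ᶠ q : ℝ × ℝ in 𝓝 (0, y₀), S.IsArc q.1 z (x₀, q.2)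
        (x₁, (S.flow q.1 z (τ q) (x₀, q.2)).2) (fun t => S.flow q.1 z t (x₀, q.2)) (τ q))
    {Y : ℝ → ℝ} {Y' : ℝ} (hY : HasDerivAt Y Y' 0) (hY0 : Y 0 = y₀) :
    HasDerivAt (fun ε => (S.flow ε z (τ (ε, Y ε)) (x₀, Y ε)).2)
      ((S.lineInt z γ T + (S.H z).dy (x₀, y₀) * Y') / (S.H z).dy (x₁, y₁)) 0 := by
  have hγ' : ∀ t, S.flow 0 z t (x₀, y₀) = γ t := fun t => by rw [h.eq_flow]
  have hq : HasDerivAt (fun ε => (ε, Y ε)) (1, Y') 0 := (hasDerivAt_id (0 : ℝ)).prodMk hY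
  have hqc : ContinuousAt (fun ε => (ε, Y ε)) 0 := hq.continuousAt
  have hτd : DifferentiableAt ℝ (fun ε => τ (ε, Y ε)) 0 := by
    refine DifferentiableAt.comp (f := fun ε => (ε, Y ε)) 0 ?_ hq.differentiableAt
    rw [hY0]
    exact hτ.differentiableAt (by norm_num)
  have hEnd : DifferentiableAt ℝ (fun ε => (S.flow ε z (τ (ε, Y ε)) (x₀, Y ε)).2) 0 := by
    have : DifferentiableAt ℝ (fun ε => (ε, τ (ε, Y ε), (x₀, Y ε))) 0 :=
      differentiableAt_id.prodMk (hτd.prodMk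
        ((differentiableAt_const x₀).prodMk hY.differentiableAt))
    exact (DifferentiableAt.comp (f := fun ε => (ε, τ (ε, Y ε), (x₀, Y ε))) 0
      ((S.contDiff_flow z (n := 1)).differentiable (by norm_num) _) this).snd
  let W : ℝ → ℝ := fun ε => ∫ t in (0 : ℝ)..τ (ε, Y ε), S.power z (S.flow ε z t (x₀, Y ε))
  have hWc : ContinuousAt W 0 := by
    have hc : Continuous fun w : (ℝ × ℝ) × ℝ =>
        ∫ t in (0 : ℝ)..w.2, S.power z (S.flow w.1.1 z t (x₀, w.1.2)) := by
      refine intervalIntegral.continuous_parametric_primitive_of_continuous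
        (f := fun (q : ℝ × ℝ) t => S.power z (S.flow q.1 z t (x₀, q.2))) ?_
      exact (S.continuous_power z).comp ((S.continuous_flow z).comp
        (f := fun w : (ℝ × ℝ) × ℝ => (w.1.1, w.2, (x₀, w.1.2))) (by fun_prop))
    exact ContinuousAt.comp (f := fun ε => ((ε, Y ε), τ (ε, Y ε))) hc.continuousAt
      (hqc.prodMk hτd.continuousAt)
  have hW0 : W 0 = S.lineInt z γ T := by
    rw [h.sol.lineInt_eq]
    simp only [W, hY0, hτ0, hγ']
  -- The balance is exact for each small ε. Both abscissas are fixed, so its derivative at 0 is a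
  -- linear equation for the derivative of the final ordinate.
  have hbal : (fun ε => (S.H z).val (x₁, (S.flow ε z (τ (ε, Y ε)) (x₀, Y ε)).2)) =ᶠ[𝓝 0]
      fun ε => (S.H z).val (x₀, Y ε) + ε * W ε := by
    have : ∀ᶠ ε in 𝓝 0, S.IsArc ε z (x₀, Y ε)
        (x₁, (S.flow ε z (τ (ε, Y ε)) (x₀, Y ε)).2) (fun t => S.flow ε z t (x₀, Y ε))
        (τ (ε, Y ε)) := by
      refine Tendsto.eventually (f := fun ε => (ε, Y ε)) ?_ harc
      rw [← hY0]
      exact hqc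
    filter_upwards [this] with ε ha
    have := ha.sol.energy_sub (τ (ε, Y ε))
    rw [ha.term, S.flow_zero] at this
    simp only [W]
    linarith
  have hE := (S.H z).hasDerivAt_val_comp ((hasDerivAt_const (0 : ℝ) x₁).prodMk hEnd.hasDerivAt)
  have hE' := (((S.H z).hasDerivAt_val_comp ((hasDerivAt_const (0 : ℝ) x₀).prodMk hY)).add
    (hasDerivAt_mul_of_continuousAt hWc)).congr_of_eventuallyEq hbal
  have key := hE.unique hE'
  have hend : S.flow 0 z T (x₀, y₀) = (x₁, y₁) := by rw [hγ', h.term]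
  simp only [hY0, hτ0, hend, hW0, mul_zero, zero_add] at key
  refine hEnd.hasDerivAt.congr_deriv ?_
  rw [eq_div_iff h₁, mul_comm, key]
  ring

end Sys

/-! ### Simple zeros -/

/-- The derivative of f is differentiable at 0, so it deviates from c by at most C|x|; the mean
value inequality on the segment from 0 to ε then gives C ε². -/
theorem isBigO_sq_of_contDiffAt {f : ℝ → ℝ} {c : ℝ} (hf : ContDiffAt ℝ 2 f 0)
    (hc : HasDerivAt f c 0) :
    (fun ε : ℝ => f ε - f 0 - ε * c) =O[𝓝 0] (fun ε : ℝ => ε ^ 2) := by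
  have hf' : DifferentiableAt ℝ (deriv f) 0 := by
    have h1 : ContDiffAt ℝ 1 (fderiv ℝ f) 0 := hf.fderiv_right (by norm_num)
    have h2 := h1.differentiableAt (by norm_num)
    exact h2.clm_apply (differentiableAt_const 1)
  obtain ⟨C, hC⟩ := hf'.isBigO_sub.bound
  have hd : ∀ᶠ ε in 𝓝 (0 : ℝ), DifferentiableAt ℝ f ε := by
    filter_upwards [hf.eventually (by simp)] with ε h using h.differentiableAt (by norm_num)
  obtain ⟨r, hr, hball⟩ := Metric.eventually_nhds_iff_ball.1 (hd.and hC)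
  refine Asymptotics.IsBigO.of_bound C ?_
  filter_upwards [Metric.ball_mem_nhds (0 : ℝ) hr] with ε hε
  have hs : ∀ x ∈ uIcc 0 ε, x ∈ Metric.ball (0 : ℝ) r ∧ |x| ≤ |ε| := by
    intro x hx
    have : |x| ≤ |ε| := by simpa using abs_sub_left_of_mem_uIcc hx
    refine ⟨?_, this⟩
    rw [mem_ball_zero_iff, Real.norm_eq_abs] at hε ⊢
    linarith
  -- The constant from `bound` carries no sign, but the bound at any ε ≠ 0 forces it to be
  -- nonnegative.
  have hCn : 0 ≤ C ∨ ε = 0 := by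
    by_cases h : ε = 0
    · exact Or.inr h
    · left
      have h1 := (hball ε hε).2
      have h2 : 0 < ‖ε - 0‖ := by simpa using h
      by_contra! hneg
      nlinarith [norm_nonneg (deriv f ε - deriv f 0)]
  rcases hCn with hCn | rfl
  · have := (convex_uIcc (0 : ℝ) ε).norm_image_sub_le_of_norm_hasDerivWithin_le
      (f := fun x => f x - x * c) (f' := fun x => deriv f x - c) (C := C * |ε|)
      (fun x hx => (((hball x (hs x hx).1).1.hasDerivAt.sub
        ((hasDerivAt_id x).mul_const c)).congr_deriv (by simp)).hasDerivWithinAt)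
      (fun x hx => by
        have h1 := (hball x (hs x hx).1).2
        rw [hc.deriv, sub_zero, Real.norm_eq_abs x] at h1
        exact h1.trans (mul_le_mul_of_nonneg_left (hs x hx).2 hCn))
      left_mem_uIcc right_mem_uIcc
    calc ‖f ε - f 0 - ε * c‖ = ‖f ε - ε * c - (f 0 - 0 * c)‖ := by congr 1; ring
      _ ≤ C * |ε| * ‖ε - 0‖ := this
      _ = C * ‖ε ^ 2‖ := by simp [pow_two, mul_assoc]
  · simp

/-- The partial derivative in the first variable at `0` is a directional derivative. -/
theorem deriv_fst_eventuallyEq {F : ℝ × ℝ → ℝ} {y₀ : ℝ} (hF : ContDiffAt ℝ 2 F (0, y₀)) :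
    (fun y => deriv (fun ε => F (ε, y)) 0) =ᶠ[𝓝 y₀] fun y => fderiv ℝ F (0, y) (1, 0) := by
  have hyt : Tendsto (fun y : ℝ => ((0 : ℝ), y)) (𝓝 y₀) (𝓝 (0, y₀)) :=
    (continuous_const.prodMk continuous_id).continuousAt
  filter_upwards [hyt.eventually (hF.eventually (by simp))] with y h
  exact ((h.differentiableAt (by norm_num)).hasFDerivAt.comp_hasDerivAt (0 : ℝ)
    ((hasDerivAt_id (0 : ℝ)).prodMk (hasDerivAt_const (0 : ℝ) y))).deriv

theorem differentiableAt_deriv_fst {F : ℝ × ℝ → ℝ} {y₀ : ℝ} (hF : ContDiffAt ℝ 2 F (0, y₀)) :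
    DifferentiableAt ℝ (fun y => deriv (fun ε => F (ε, y)) 0) y₀ := by
  have hG : ContDiffAt ℝ 1 (fun q => fderiv ℝ F q (1, 0)) (0, y₀) :=
    (hF.fderiv_right (by norm_num)).clm_apply contDiffAt_const
  refine DifferentiableAt.congr_of_eventuallyEq ?_ (deriv_fst_eventuallyEq hF)
  exact DifferentiableAt.comp (f := fun y : ℝ => ((0 : ℝ), y)) y₀
    (hG.differentiableAt (by norm_num)) (by fun_prop)

/-- A simple zero of the first order term of `F (ε, y) = O(ε)` continues to a unique zero of
`F (ε, ·)` for small `ε > 0`. -/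
theorem exists_unique_zero_of_simple {F : ℝ × ℝ → ℝ} {y₀ : ℝ} (hF : ContDiffAt ℝ 2 F (0, y₀))
    (hF0 : ∀ᶠ y in 𝓝 y₀, F (0, y) = 0) (hm : deriv (fun ε => F (ε, y₀)) 0 = 0)
    (hm' : deriv (fun y => deriv (fun ε => F (ε, y)) 0) y₀ ≠ 0) :
    ∃ r > 0, ∀ δ ∈ Ioc 0 r, ∀ᶠ ε in 𝓝[>] 0, ∃ y ∈ Ioo (y₀ - δ) (y₀ + δ), F (ε, y) = 0 ∧
      ∀ y' ∈ Ioo (y₀ - r) (y₀ + r), F (ε, y') = 0 → y' = y := by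
  -- G is ∂F/∂ε. It replaces the quotient F/ε, whose regularity at ε = 0 would need a separate
  -- argument.
  let G : ℝ × ℝ → ℝ := fun q => fderiv ℝ F q (1, 0)
  have hG : ContDiffAt ℝ 1 G (0, y₀) := (hF.fderiv_right (by norm_num)).clm_apply contDiffAt_const
  have hFd : ∀ᶠ q in 𝓝 (0, y₀), HasFDerivAt F (fderiv ℝ F q) q := by
    filter_upwards [hF.eventually (by simp)] with q h
      using (h.differentiableAt (by norm_num)).hasFDerivAt
  have hGd : ∀ᶠ q in 𝓝 (0, y₀), HasFDerivAt G (fderiv ℝ G q) q := by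
    filter_upwards [hG.eventually (by simp)] with q h
      using (h.differentiableAt (by norm_num)).hasFDerivAt
  have hFε : ∀ᶠ q : ℝ × ℝ in 𝓝 (0, y₀), HasDerivAt (fun e => F (e, q.2)) (G q) q.1 := by
    filter_upwards [hFd] with q h
    exact h.comp_hasDerivAt q.1 ((hasDerivAt_id q.1).prodMk (hasDerivAt_const q.1 q.2))
  have hGy : ∀ᶠ q : ℝ × ℝ in 𝓝 (0, y₀),
      HasDerivAt (fun y => G (q.1, y)) (fderiv ℝ G q (0, 1)) q.2 := by
    filter_upwards [hGd] with q h
    exact h.comp_hasDerivAt q.2 ((hasDerivAt_const q.2 q.1).prodMk (hasDerivAt_id q.2))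
  have hmG : (fun y => deriv (fun ε => F (ε, y)) 0) =ᶠ[𝓝 y₀] fun y => G (0, y) :=
    deriv_fst_eventuallyEq hF
  rw [hmG.deriv_eq, hGy.self_of_nhds.deriv] at hm'
  have hGm : G (0, y₀) = 0 := hmG.self_of_nhds.symm.trans hm
  have hGc : ContinuousAt (fun q => fderiv ℝ G q (0, 1)) (0, y₀) :=
    (hG.fderiv_right (m := 0) (by norm_num)).continuousAt.clm_apply continuousAt_const
  have hne : ∀ᶠ q in 𝓝 (0, y₀), fderiv ℝ G q (0, 1) ≠ 0 := hGc.eventually_ne hm'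
  have hcont : ∀ᶠ q in 𝓝 (0, y₀), ContinuousAt F q := by
    filter_upwards [hFd] with q h using h.continuousAt
  have hall := (hFε.and (hGy.and (hne.and hcont)))
  obtain ⟨r₁, hr₁, hball⟩ := Metric.eventually_nhds_iff_ball.1 hall
  obtain ⟨r₂, hr₂, hball₂⟩ := Metric.eventually_nhds_iff_ball.1 hF0
  have hmem : ∀ e y, |e| < r₁ → |y - y₀| < r₁ → (e, y) ∈ Metric.ball ((0 : ℝ), y₀) r₁ := by
    intro e y he hy
    rw [← ball_prod_same]
    exact ⟨by simpa using he, by simpa [Real.dist_eq] using hy⟩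
  set r := min r₁ r₂ / 2 with hr
  have hr0 : 0 < r := by positivity
  have hrr₁ : r < r₁ := by have := min_le_left r₁ r₂; linarith [lt_min hr₁ hr₂]
  have hrr₂ : r < r₂ := by have := min_le_right r₁ r₂; linarith [lt_min hr₁ hr₂]
  refine ⟨r, hr0, fun δ hδ => ?_⟩
  -- injectivity of the zero, by Rolle's theorem in each variable
  have huniq : ∀ ε, 0 < ε → ε < r₁ → ∀ y ∈ Ioo (y₀ - r) (y₀ + r), ∀ y' ∈ Ioo (y₀ - r) (y₀ + r),
      y < y' → F (ε, y) = 0 → F (ε, y') ≠ 0 := by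
    intro ε hε hεr y hy y' hy' hlt h h'
    have hyr : |y - y₀| < r := abs_sub_lt_iff.2 ⟨by linarith [hy.2], by linarith [hy.1]⟩
    have hyr' : |y' - y₀| < r := abs_sub_lt_iff.2 ⟨by linarith [hy'.2], by linarith [hy'.1]⟩
    have hd : ∀ e ∈ Icc 0 ε,
        HasDerivAt (fun e => F (e, y) - F (e, y')) (G (e, y) - G (e, y')) e := fun e he => by
      have he' : |e| < r₁ := by rw [abs_of_nonneg he.1]; linarith [he.2]
      exact (hball _ (hmem e y he' (by linarith))).1.sub (hball _ (hmem e y' he' (by linarith))).1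
    obtain ⟨e, he, hGe⟩ := exists_hasDerivAt_eq_zero (f := fun e => F (e, y) - F (e, y'))
      (f' := fun e => G (e, y) - G (e, y')) hε
      (fun e he => (hd e he).continuousAt.continuousWithinAt)
      (by
        have h1 : F (0, y) = 0 := hball₂ y (by rw [Metric.mem_ball, Real.dist_eq]; linarith)
        have h2 : F (0, y') = 0 := hball₂ y' (by rw [Metric.mem_ball, Real.dist_eq]; linarith)
        simp [h, h', h1, h2])
      (fun e he => hd e (Ioo_subset_Icc_self he))
    have he' : |e| < r₁ := by rw [abs_of_pos he.1]; linarith [he.2]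
    have hd' : ∀ s ∈ Icc y y', |s - y₀| < r₁ := fun s hs => by
      rw [abs_sub_lt_iff]
      constructor <;> linarith [hs.1, hs.2, hy.1, hy'.2]
    obtain ⟨s, hs, hGs⟩ := exists_hasDerivAt_eq_zero (f := fun s => G (e, s))
      (f' := fun s => fderiv ℝ G (e, s) (0, 1)) hlt
      (fun s hs => (hball _ (hmem e s he' (hd' s hs))).2.1.continuousAt.continuousWithinAt)
      (by linarith) (fun s hs => (hball _ (hmem e s he' (hd' s (Ioo_subset_Icc_self hs)))).2.1)
    exact (hball _ (hmem e s he' (hd' s (Ioo_subset_Icc_self hs)))).2.2.1 hGs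
  have huniq' : ∀ ε, 0 < ε → ε < r₁ → ∀ y ∈ Ioo (y₀ - r) (y₀ + r), ∀ y' ∈ Ioo (y₀ - r) (y₀ + r),
      F (ε, y) = 0 → F (ε, y') = 0 → y' = y := by
    intro ε hε hεr y hy y' hy' h h'
    rcases lt_trichotomy y y' with hlt | he | hlt
    · exact absurd h' (huniq ε hε hεr y hy y' hy' hlt h)
    · exact he.symm
    · exact absurd h (huniq ε hε hεr y' hy' y hy hlt h')
  -- points on both sides of `y₀` where the first order term has opposite signs
  have hopp : ∃ y₁ ∈ Ioo (y₀ - δ) (y₀ + δ), ∃ y₂ ∈ Ioo (y₀ - δ) (y₀ + δ),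
      G (0, y₁) < 0 ∧ 0 < G (0, y₂) := by
    have hd : HasDerivAt (fun y => G (0, y)) (fderiv ℝ G (0, y₀) (0, 1)) y₀ := hGy.self_of_nhds
    have hsl := hasDerivAt_iff_tendsto_slope.1 hd
    have hR : ∀ᶠ y in 𝓝[>] y₀, y ∈ Ioo (y₀ - δ) (y₀ + δ) ∧
        0 < (fderiv ℝ G (0, y₀) (0, 1)) * G (0, y) := by
      have h1 := hsl.mono_left (nhdsWithin_mono y₀ (s := Ioi y₀) fun t ht => (mem_Ioi.1 ht).ne')
      have h2 := (h1.const_mul (fderiv ℝ G (0, y₀) (0, 1))).eventually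
        (eventually_gt_nhds (mul_self_pos.2 hm'))
      filter_upwards [h2, Ioo_mem_nhdsGT (show y₀ < y₀ + δ by linarith [hδ.1])] with y h hy
      refine ⟨⟨by linarith [hy.1, hδ.1], hy.2⟩, ?_⟩
      rw [slope_def_field, hGm, sub_zero, ← mul_div_assoc] at h
      exact (div_pos_iff_of_pos_right (by linarith [hy.1])).1 h
    have hL : ∀ᶠ y in 𝓝[<] y₀, y ∈ Ioo (y₀ - δ) (y₀ + δ) ∧
        (fderiv ℝ G (0, y₀) (0, 1)) * G (0, y) < 0 := by
      have h1 := hsl.mono_left (nhdsWithin_mono y₀ (s := Iio y₀) fun t ht => (mem_Iio.1 ht).ne)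
      have h2 := (h1.const_mul (fderiv ℝ G (0, y₀) (0, 1))).eventually
        (eventually_gt_nhds (mul_self_pos.2 hm'))
      filter_upwards [h2, Ioo_mem_nhdsLT (show y₀ - δ < y₀ by linarith [hδ.1])] with y h hy
      refine ⟨⟨hy.1, by linarith [hy.2, hδ.1]⟩, ?_⟩
      rw [slope_def_field, hGm, sub_zero, ← mul_div_assoc] at h
      rcases div_pos_iff.1 h with h | h
      · linarith [hy.2]
      · exact h.1
    obtain ⟨y₂, hy₂, hs₂⟩ := hR.exists
    obtain ⟨y₁, hy₁, hs₁⟩ := hL.exists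
    rcases lt_or_gt_of_ne hm' with hn | hp
    · exact ⟨y₂, hy₂, y₁, hy₁, by nlinarith, by nlinarith⟩
    · exact ⟨y₁, hy₁, y₂, hy₂, by nlinarith, by nlinarith⟩
  obtain ⟨y₁, hy₁, y₂, hy₂, hs₁, hs₂⟩ := hopp
  -- Since F(0, y) = 0, the quotient tends to G(0, y); the opposite signs of G at y₁ and y₂ thus
  -- pass to F(ε, ·), and the intermediate value theorem gives the zero.
  have hslope : ∀ y ∈ Ioo (y₀ - δ) (y₀ + δ),
      Tendsto (fun ε => F (ε, y) / ε) (𝓝[>] 0) (𝓝 (G (0, y))) := by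
    intro y hy
    have hyr : |y - y₀| < r := abs_sub_lt_iff.2
      ⟨by linarith [hy.2, hδ.2], by linarith [hy.1, hδ.2]⟩
    have hd := (hball _ (hmem 0 y (by simpa using hr₁) (by linarith))).1
    have h0 : F (0, y) = 0 := hball₂ y (by rw [Metric.mem_ball, Real.dist_eq]; linarith)
    have h1 := (hasDerivAt_iff_tendsto_slope.1 hd).mono_left
      (nhdsWithin_mono 0 (s := Ioi 0) fun t ht => (mem_Ioi.1 ht).ne')
    refine h1.congr fun ε => ?_
    rw [slope_def_field, h0, sub_zero, sub_zero]
  filter_upwards [(hslope y₁ hy₁).eventually (eventually_lt_nhds hs₁),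
    (hslope y₂ hy₂).eventually (eventually_gt_nhds hs₂),
    Ioo_mem_nhdsGT hr₁] with ε h1 h2 hε
  have h1' : F (ε, y₁) < 0 := by
    rcases div_neg_iff.1 h1 with h | h
    · linarith [hε.1, h.2]
    · exact h.1
  have h2' : 0 < F (ε, y₂) := (div_pos_iff_of_pos_right hε.1).1 h2
  have hsub : uIcc y₁ y₂ ⊆ Ioo (y₀ - δ) (y₀ + δ) := ordConnected_Ioo.uIcc_subset hy₁ hy₂
  have hco : ContinuousOn (fun y => F (ε, y)) (uIcc y₁ y₂) := by
    intro y hy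
    have hy' := hsub hy
    have hyr : |y - y₀| < r := abs_sub_lt_iff.2
      ⟨by linarith [hy'.2, hδ.2], by linarith [hy'.1, hδ.2]⟩
    have hc := (hball _ (hmem ε y (by rw [abs_of_pos hε.1]; exact hε.2) (by linarith))).2.2.2
    exact (ContinuousAt.comp (f := fun y => (ε, y)) hc
      (continuousAt_const.prodMk continuousAt_id)).continuousWithinAt
  obtain ⟨y, hy, hFy⟩ := intermediate_value_uIcc hco (mem_uIcc.2 (Or.inl ⟨h1'.le, h2'.le⟩))
  have hyδ := hsub hy
  refine ⟨y, hyδ, hFy, fun y' hy' hFy' => huniq' ε hε.1 hε.2 y ?_ y' hy' hFy hFy'⟩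
  exact ⟨by linarith [hyδ.1, hδ.2], by linarith [hyδ.2, hδ.2]⟩

end PWHam

namespace PWHam

/-! ### Cycles of arcs -/

/-- A crossing periodic orbit of the unperturbed system, run through the zones `z i` from the
lines of abscissa `x i`, with cyclic index `i`. -/
structure Cycle (S : Sys) {k : ℕ} (z : ZMod k → Zone) (x : ZMod k → ℝ) where
  y : ZMod k → ℝ
  γ : ZMod k → ℝ → ℝ × ℝ
  T : ZMod k → ℝ
  cross : ∀ i, S.IsCrossing 0 (x i, y i)
  arc : ∀ i, S.IsArc 0 (z i) (x i, y i) (x (i + 1), y (i + 1)) (γ i) (T i)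

namespace Sys

theorem IsArc.field_start_ne_zero {S : Sys} {ε : ℝ} {z : Zone} {p q : ℝ × ℝ} {γ : ℝ → ℝ × ℝ}
    {T : ℝ} (h : S.IsArc ε z p q γ T) (hp : S.IsCrossing ε p) : (S.field ε z p).1 ≠ 0 := by
  obtain ⟨σ, hσ, -⟩ := h.start hp.line
  exact hp.field_ne_zero hσ

theorem IsArc.field_end_ne_zero {S : Sys} {ε : ℝ} {z : Zone} {p q : ℝ × ℝ} {γ : ℝ → ℝ × ℝ}
    {T : ℝ} (h : S.IsArc ε z p q γ T) (hq : S.IsCrossing ε q) : (S.field ε z q).1 ≠ 0 := by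
  obtain ⟨σ, hσ, -⟩ := h.end hq.line
  exact hq.field_ne_zero hσ

theorem IsCrossing.eventually {S : Sys} {x y : ℝ} (h : S.IsCrossing 0 (x, y)) :
    ∀ᶠ q : ℝ × ℝ in 𝓝 (0, y), S.IsCrossing q.1 (x, q.2) := by
  have hc : ∀ z, Continuous fun q : ℝ × ℝ => (S.field q.1 z (x, q.2)).1 := fun z =>
    continuous_fst.comp ((S.continuous_field z).comp
      (f := fun q : ℝ × ℝ => (q.1, (x, q.2))) (by fun_prop))
  rcases h with ⟨hx, h⟩ | ⟨hx, h⟩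
  · filter_upwards [((hc Zone.C).mul (hc Zone.R)).continuousAt.eventually
      (eventually_gt_nhds h)] with q hq using Or.inl ⟨hx, hq⟩
  · filter_upwards [((hc Zone.L).mul (hc Zone.C)).continuousAt.eventually
      (eventually_gt_nhds h)] with q hq using Or.inr ⟨hx, hq⟩

end Sys

namespace Cycle

variable {S : Sys} {k : ℕ} {z : ZMod k → Zone} {x : ZMod k → ℝ} (c : Cycle S z x)

theorem line {S : Sys} {k : ℕ} {z : ZMod k → Zone} {x : ZMod k → ℝ} (c : Cycle S z x)
    (i : ZMod k) : x i = 1 ∨ x i = -1 := (c.cross i).line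

theorem exists_time (i : ZMod k) :
    ∃ τ : ℝ × ℝ → ℝ, τ (0, c.y i) = c.T i ∧ ContDiffAt ℝ 2 τ (0, c.y i) ∧
      ∀ᶠ q : ℝ × ℝ in 𝓝 (0, c.y i), S.IsArc q.1 (z i) (x i, q.2)
        (x (i + 1), (S.flow q.1 (z i) (τ q) (x i, q.2)).2)
        (fun t => S.flow q.1 (z i) t (x i, q.2)) (τ q) :=
  Sys.exists_transition (c.arc i) (c.line i) (c.line (i + 1))
    ((c.arc i).field_start_ne_zero (c.cross i)) ((c.arc i).field_end_ne_zero (c.cross (i + 1)))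

/-- The transition time along the arc `i`, as a function of `(ε, y)`. -/
noncomputable def time (i : ZMod k) : ℝ × ℝ → ℝ := (c.exists_time i).choose

theorem time_zero (i : ZMod k) : c.time i (0, c.y i) = c.T i := (c.exists_time i).choose_spec.1

theorem contDiffAt_time (i : ZMod k) : ContDiffAt ℝ 2 (c.time i) (0, c.y i) :=
  (c.exists_time i).choose_spec.2.1

/-- The transition map along the arc `i`, as a function of `(ε, y)`. -/
noncomputable def step (i : ZMod k) (q : ℝ × ℝ) : ℝ :=
  (S.flow q.1 (z i) (c.time i q) (x i, q.2)).2

theorem eventually_arc_step (i : ZMod k) :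
    ∀ᶠ q : ℝ × ℝ in 𝓝 (0, c.y i), S.IsArc q.1 (z i) (x i, q.2) (x (i + 1), c.step i q)
        (fun t => S.flow q.1 (z i) t (x i, q.2)) (c.time i q) :=
  (c.exists_time i).choose_spec.2.2

theorem step_zero (i : ZMod k) : c.step i (0, c.y i) = c.y (i + 1) := by
  rw [step, c.time_zero]
  have := (c.arc i).term
  rw [(c.arc i).eq_flow] at this
  exact congrArg Prod.snd this

theorem contDiffAt_step (i : ZMod k) : ContDiffAt ℝ 2 (c.step i) (0, c.y i) := by
  have : ContDiffAt ℝ 2 (fun q : ℝ × ℝ => (q.1, c.time i q, (x i, q.2))) (0, c.y i) :=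
    contDiffAt_fst.prodMk ((c.contDiffAt_time i).prodMk (contDiffAt_const.prodMk contDiffAt_snd))
  exact (ContDiffAt.comp (f := fun q : ℝ × ℝ => (q.1, c.time i q, (x i, q.2))) (0, c.y i)
    (S.contDiff_flow (z i)).contDiffAt this).snd

/-- The ordinate reached from `(x 0, y)` after `n` arcs, as a function of `(ε, y)`. -/
noncomputable def pos : ℕ → ℝ × ℝ → ℝ
  | 0, q => q.2
  | n + 1, q => c.step (n : ZMod k) (q.1, pos n q)

theorem pos_succ (n : ℕ) (q : ℝ × ℝ) : c.pos (n + 1) q = c.step n (q.1, c.pos n q) := rfl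

theorem pos_zero (n : ℕ) : c.pos n (0, c.y 0) = c.y n := by
  induction n with
  | zero => simp [pos]
  | succ n ih => rw [pos_succ, ih, step_zero, Nat.cast_succ]

theorem contDiffAt_pos (n : ℕ) : ContDiffAt ℝ 2 (c.pos n) (0, c.y 0) := by
  induction n with
  | zero => exact contDiffAt_snd
  | succ n ih =>
    refine ContDiffAt.comp (f := fun q : ℝ × ℝ => (q.1, c.pos n q)) (0, c.y 0) ?_
      (contDiffAt_fst.prodMk ih)
    simp only [pos_zero]
    exact c.contDiffAt_step n

theorem tendsto_pos (n : ℕ) :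
    Tendsto (fun q : ℝ × ℝ => (q.1, c.pos n q)) (𝓝 (0, c.y 0)) (𝓝 (0, c.y n)) := by
  have : ContinuousAt (fun q : ℝ × ℝ => (q.1, c.pos n q)) (0, c.y 0) :=
    continuousAt_fst.prodMk (c.contDiffAt_pos n).continuousAt
  simpa only [ContinuousAt, pos_zero] using this

/-- The arc number `n` of the orbit from `(x 0, q.2)`, with the parameter `q.1`. -/
def Follows (q : ℝ × ℝ) (n : ℕ) : Prop :=
  S.IsArc q.1 (z n) (x n, c.pos n q) (x (n + 1 : ℕ), c.pos (n + 1) q)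
    (fun t => S.flow q.1 (z n) t (x n, c.pos n q)) (c.time n (q.1, c.pos n q))

theorem eventually_follows (n : ℕ) : ∀ᶠ q in 𝓝 (0, c.y 0), c.Follows q n := by
  filter_upwards [(c.tendsto_pos n).eventually (c.eventually_arc_step n)] with q hq
  rw [Follows, Nat.cast_succ]
  exact hq

/-- The first order variations of the successive points. -/
noncomputable def var : ℕ → ℝ
  | 0 => 0
  | n + 1 => (S.lineInt (z n) (c.γ n) (c.T n) + (S.H (z n)).dy (x n, c.y n) * var n) /
      (S.H (z n)).dy (x (n + 1), c.y (n + 1))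

theorem hasDerivAt_pos (n : ℕ) : HasDerivAt (fun ε => c.pos n (ε, c.y 0)) (c.var n) 0 := by
  induction n with
  | zero => exact hasDerivAt_const _ _
  | succ n ih =>
    refine Sys.hasDerivAt_transition (c.arc n) ?_ (c.time_zero n) (c.contDiffAt_time n)
      (c.eventually_arc_step n) ih (c.pos_zero n)
    rw [← Sys.field_zero_fst]
    exact (c.arc n).field_end_ne_zero (c.cross _)

/-- The k-fold composition of transition maps is C² and `hk` closes the chain at ε = 0, so this is
Taylor's formula for K along the end point, with `var k` as its ε-derivative. -/
theorem melnikov (hk : (k : ZMod k) = 0) (K : Ham) :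
    ∃ ε₀ > 0, (∀ ε ∈ Ico 0 ε₀, ∀ n < k, c.Follows (ε, c.y 0) n) ∧
    (fun ε : ℝ => K.val (x 0, c.pos k (ε, c.y 0)) - K.val (x 0, c.y 0) -
      ε * (K.dy (x 0, c.y 0) * c.var k)) =O[𝓝[≥] 0] (fun ε : ℝ => ε ^ 2) := by
  have ht : Tendsto (fun ε : ℝ => (ε, c.y 0)) (𝓝 0) (𝓝 (0, c.y 0)) :=
    (continuous_id.prodMk continuous_const).continuousAt
  have h1 : ∀ᶠ ε in 𝓝 (0 : ℝ), ∀ n ∈ Finset.range k, c.Follows (ε, c.y 0) n :=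
    (Finset.eventually_all _).2 fun n _ => ht.eventually (c.eventually_follows n)
  obtain ⟨r, hr, hball⟩ := Metric.eventually_nhds_iff_ball.1 h1
  refine ⟨r, hr, fun ε hε n hn => hball ε ?_ n (Finset.mem_range.2 hn), ?_⟩
  · simpa [abs_of_nonneg hε.1] using hε.2
  have h0 : c.pos k (0, c.y 0) = c.y 0 := by rw [pos_zero, hk]
  have hcd : ContDiffAt ℝ 2 (fun ε : ℝ => c.pos k (ε, c.y 0)) 0 :=
    ContDiffAt.comp (f := fun ε : ℝ => (ε, c.y 0)) 0 (c.contDiffAt_pos k)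
      (contDiffAt_id.prodMk contDiffAt_const)
  have hval : ContDiffAt ℝ 2 (fun ε : ℝ => K.val (x 0, c.pos k (ε, c.y 0))) 0 := by
    unfold Ham.val
    fun_prop
  have hd := K.hasDerivAt_val_comp ((hasDerivAt_const (0 : ℝ) (x 0)).prodMk (c.hasDerivAt_pos k))
  simp only [h0, mul_zero, zero_add] at hd
  have := isBigO_sq_of_contDiffAt hval hd
  simp only [h0] at this
  exact this.mono nhdsWithin_le_nhds

/-- Induction on uniqueness of arcs. This makes the Poincaré map independent of the cycle at which
the implicit functions were taken. -/
theorem eq_pos_of_connects {q : ℝ × ℝ} (hq : ∀ n < k, c.Follows q n) {s : ℕ → ℝ}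
    (h0 : s 0 = q.2) (hs : ∀ n < k, S.Connects q.1 (z n) (x n, s n) (x (n + 1 : ℕ), s (n + 1))) :
    ∀ n ≤ k, s n = c.pos n q := by
  intro n
  induction n with
  | zero => exact fun _ => h0
  | succ n ih =>
    intro hn
    obtain ⟨γ, T, h⟩ := hs n hn
    rw [ih (Nat.le_of_succ_le hn)] at h
    have := (h.unique (hq n hn) (c.line _) (c.line _)).2.2
    exact congrArg Prod.snd this

/-- The periodic orbit as a set. -/
def orbit : Set (ℝ × ℝ) := ⋃ i, c.γ i '' Icc 0 (c.T i)

/-! ### Orbits near a cycle leave every closed zone -/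

theorem isCompact_orbit [NeZero k] : IsCompact c.orbit :=
  isCompact_iUnion fun i => isCompact_Icc.image (c.arc i).sol.continuous

theorem exists_notMem_closure_vertex (i : ZMod k) (w : Zone) :
    ∃ t, S.flow 0 w t (x i, c.y i) ∉ closure w.region :=
  Sys.exists_flow_notMem_closure (c.line i) fun _ hσ => (c.cross i).field_ne_zero hσ

/-- A vertex is left transversally. An interior point of an arc is already outside the other closed
zones, and in its own zone it flows to the final vertex of the arc. -/
theorem exists_notMem_closure {p : ℝ × ℝ} (hp : p ∈ c.orbit) (w : Zone) :
    ∃ t, S.flow 0 w t p ∉ closure w.region := by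
  obtain ⟨i, s, hs, rfl⟩ := mem_iUnion.1 hp
  rcases eq_or_lt_of_le hs.1 with rfl | h0
  · rw [(c.arc i).init]
    exact c.exists_notMem_closure_vertex i w
  rcases eq_or_lt_of_le hs.2 with rfl | h1
  · rw [(c.arc i).term]
    exact c.exists_notMem_closure_vertex (i + 1) w
  by_cases hw : c.γ i s ∈ closure w.region
  · obtain rfl := eq_of_mem_region_of_mem_closure ((c.arc i).inside s ⟨h0, h1⟩) hw
    obtain ⟨t, ht⟩ := c.exists_notMem_closure_vertex (i + 1) (z i)
    rw [← (c.arc i).term, (c.arc i).sol.flow_eq] at ht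
    refine ⟨t + c.T i - s, ?_⟩
    rwa [(c.arc i).sol.flow_eq, sub_add_cancel]
  · exact ⟨0, by rwa [S.flow_zero]⟩

/-- Near a cycle there are no periodic orbits in a single zone. -/
theorem exists_nhd_no_oneZone [NeZero k] : ∃ N : Set (ℝ × ℝ), IsOpen N ∧ c.orbit ⊆ N ∧
    ∀ᶠ ε in 𝓝 (0 : ℝ), ∀ Γ ⊆ N, ¬ S.IsOneZonePeriodicOrbit ε Γ := by
  -- Being outside the closed zone at a given time is an open condition in (ε, p); compactness of
  -- the cycle makes it uniform.
  have h1 : ∀ w : Zone, {v : ℝ × (ℝ × ℝ) | ∃ t, S.flow v.1 w t v.2 ∉ closure w.region} ∈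
      𝓝 0 ×ˢ 𝓝ˢ c.orbit := by
    intro w
    refine c.isCompact_orbit.mem_prod_nhdsSet_of_forall fun p hp => ?_
    obtain ⟨t, ht⟩ := c.exists_notMem_closure hp w
    rw [← nhds_prod_eq]
    have hc : Continuous fun v : ℝ × (ℝ × ℝ) => S.flow v.1 w t v.2 :=
      (S.continuous_flow w).comp (f := fun v : ℝ × (ℝ × ℝ) => (v.1, t, v.2)) (by fun_prop)
    filter_upwards [hc.continuousAt.eventually
      (isClosed_closure.isOpen_compl.mem_nhds (x := S.flow 0 w t p) ht)] with v hv using ⟨t, hv⟩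
  have h2 := inter_mem (h1 Zone.L) (inter_mem (h1 Zone.C) (h1 Zone.R))
  obtain ⟨A, hA, B, hB, hAB⟩ := mem_prod_iff.1 h2
  obtain ⟨N, hNo, hN, hNB⟩ := mem_nhdsSet_iff_exists.1 hB
  refine ⟨N, hNo, hN, ?_⟩
  filter_upwards [hA] with ε hε Γ hΓ
  rintro ⟨w, γ, T, -, hsol, -, -, hcl, rfl⟩
  have h3 := hAB (mk_mem_prod hε (hNB (hΓ (mem_range_self 0))))
  have h4 : ∃ t, S.flow ε w t (γ 0) ∉ closure w.region := by
    cases w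
    exacts [h3.1, h3.2.1, h3.2.2]
  obtain ⟨t, ht⟩ := h4
  rw [hsol.flow_eq] at ht
  exact ht (hcl _)

end Cycle

/-- A crossing periodic orbit as an infinite periodic chain of arcs. -/
theorem Sys.IsCrossingPeriodicOrbit.exists_chain {S : Sys} {ε : ℝ} {Γ : Set (ℝ × ℝ)}
    (h : S.IsCrossingPeriodicOrbit ε Γ) :
    ∃ (n : ℕ) (z : ℕ → Zone) (p : ℕ → ℝ × ℝ) (γ : ℕ → ℝ → ℝ × ℝ) (T : ℕ → ℝ),
      0 < n ∧ (∀ i j, p (i + n * j) = p i) ∧ (∀ i, S.IsCrossing ε (p i)) ∧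
      (∀ i, S.IsArc ε (z i) (p i) (p (i + 1)) (γ i) (T i)) ∧
      ∀ m, Γ = ⋃ i, γ (m + i) '' Icc 0 (T (m + i)) := by
  obtain ⟨n, z, p, γ, T, hn, hp, ha, rfl⟩ := h
  refine ⟨n, fun i => z (i % n), fun i => p (i % n), fun i => γ (i % n), fun i => T (i % n), hn,
    fun i j => by simp, fun i => (ha _ (Nat.mod_lt i hn)).1, fun i => ?_, fun m => ?_⟩
  · have h1 := (ha _ (Nat.mod_lt i hn)).2
    -- At the last index i % n + 1 = n, and the closing condition p n = p 0 is what is needed.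
    have h2 : p (i % n + 1) = p ((i + 1) % n) := by
      rw [Nat.add_mod i 1 n]
      rcases Nat.lt_or_ge (i % n + 1) n with hlt | hge
      · have : 1 % n = 1 := Nat.mod_eq_of_lt (by omega)
        rw [this, Nat.mod_eq_of_lt hlt]
      · have hlt := Nat.mod_lt i hn
        have he : i % n + 1 = n := by omega
        have : (i % n + 1 % n) % n = 0 := by
          rw [Nat.add_mod_mod, he, Nat.mod_self]
        rw [this, he, hp]
    rwa [h2] at h1
  · ext v
    simp only [mem_iUnion, mem_Iio, exists_prop]
    constructor
    · rintro ⟨i, hi, hv⟩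
      -- The shift makes m plus this index congruent to i modulo n.
      refine ⟨i + (n - m % n), ?_⟩
      have hm := Nat.mod_lt m hn
      have : (m + (i + (n - m % n))) % n = i := by
        have e : m + (i + (n - m % n)) = i + n * (m / n + 1) := by
          have := Nat.mod_add_div m n
          rw [mul_add, mul_one]
          omega
        rw [e, Nat.add_mul_mod_self_left, Nat.mod_eq_of_lt hi]
      rwa [this]
    · rintro ⟨i, hv⟩
      exact ⟨_, Nat.mod_lt _ hn, hv⟩

/-- Periodic points of a strictly increasing map are fixed. -/
theorem eq_of_periodic_of_strictMonoOn {f : ℝ → ℝ} {s : Set ℝ} (hf : StrictMonoOn f s)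
    {u : ℕ → ℝ} (hu : ∀ l, u l ∈ s) (hstep : ∀ l, u (l + 1) = f (u l)) {n : ℕ} (hn : 0 < n)
    (hper : u n = u 0) : u 1 = u 0 := by
  rcases lt_trichotomy (u 0) (u 1) with h | h | h
  · have : ∀ l, u l < u (l + 1) := fun l => by
      induction l with
      | zero => exact h
      | succ l ih =>
        rw [hstep l, hstep (l + 1)]
        exact hf (hu _) (hu _) ih
    exact absurd hper (strictMono_nat_of_lt_succ this hn).ne'
  · exact h.symm
  · have : ∀ l, u (l + 1) < u l := fun l => by
      induction l with
      | zero => exact h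
      | succ l ih =>
        rw [hstep l, hstep (l + 1)]
        exact hf (hu _) (hu _) ih
    exact absurd hper (strictAnti_nat_of_succ_lt this hn).ne

end PWHam

namespace PWHam

namespace Cycle

variable {S : Sys} {k : ℕ} {z : ZMod k → Zone} {x : ZMod k → ℝ} (c : Cycle S z x)

/-! ### Periodic orbits of the perturbed system near a cycle -/

/-- The orbit of the perturbed system from `(x 0, q.2)`, with the parameter `q.1`. -/
def trace (q : ℝ × ℝ) : Set (ℝ × ℝ) :=
  ⋃ n : ℕ, (fun t => S.flow q.1 (z n) t (x n, c.pos n q)) '' Icc 0 (c.time n (q.1, c.pos n q))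

/-- The vertex `(x i, q.2)` is a crossing point and its orbit follows the arc `i`. -/
def Regular (i : ZMod k) (q : ℝ × ℝ) : Prop :=
  S.IsCrossing q.1 (x i, q.2) ∧ S.IsArc q.1 (z i) (x i, q.2) (x (i + 1), c.step i q)
    (fun t => S.flow q.1 (z i) t (x i, q.2)) (c.time i q)

theorem eventually_regular (i : ZMod k) : ∀ᶠ q in 𝓝 (0, c.y i), c.Regular i q :=
  (c.cross i).eventually.and (c.eventually_arc_step i)

/-- At a crossing point only one zone lies ahead, so the zone of an outgoing arc is forced, and then
the whole arc. -/
theorem Regular.unique {c : Cycle S z x} {i : ZMod k} {q : ℝ × ℝ} (h : c.Regular i q) {w : Zone}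
    {p' : ℝ × ℝ} {γ : ℝ → ℝ × ℝ} {T : ℝ} (ha : S.IsArc q.1 w (x i, q.2) p' γ T)
    (hp' : p'.1 = 1 ∨ p'.1 = -1) :
    p' = (x (i + 1), c.step i q) ∧ γ = (fun t => S.flow q.1 (z i) t (x i, q.2)) ∧
      T = c.time i q := by
  obtain ⟨hc, hr⟩ := h
  obtain ⟨σ, hσ, hσ'⟩ := ha.start hc.line
  obtain ⟨ρ, hρ, hρ'⟩ := hr.start hc.line
  obtain rfl := hc.zone_unique hρ hσ hρ' hσ'
  obtain ⟨h1, h2, h3⟩ := ha.unique hr hp' (c.line _)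
  exact ⟨h3, h1, h2⟩

theorem pos_add_of_fixed (hk : (k : ZMod k) = 0) {q : ℝ × ℝ} (hq : c.pos k q = q.2) (n : ℕ) :
    c.pos (n + k) q = c.pos n q := by
  induction n with
  | zero => simpa [pos] using hq
  | succ n ih =>
    rw [Nat.succ_add_eq_add_succ, Nat.add_succ, pos_succ, ih, pos_succ, Nat.cast_add, hk, add_zero]

theorem pos_mod_of_fixed (hk : (k : ZMod k) = 0) {q : ℝ × ℝ} (hq : c.pos k q = q.2) (n : ℕ) :
    c.pos (n % k) q = c.pos n q := by
  have h : ∀ j m, c.pos (m + k * j) q = c.pos m q := by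
    intro j
    induction j with
    | zero => simp
    | succ j ih =>
      intro m
      rw [mul_add, mul_one, ← add_assoc, pos_add_of_fixed c hk hq, ih]
  have := h (n / k) (n % k)
  rwa [Nat.mod_add_div, eq_comm] at this

theorem trace_eq_of_fixed [NeZero k] {q : ℝ × ℝ} (hq : c.pos k q = q.2) :
    c.trace q = ⋃ n ∈ Iio k, (fun t => S.flow q.1 (z n) t (x n, c.pos n q)) ''
      Icc 0 (c.time n (q.1, c.pos n q)) := by
  have hk : (k : ZMod k) = 0 := ZMod.natCast_self k
  ext v
  simp only [trace, mem_iUnion, mem_Iio, exists_prop]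
  constructor
  · rintro ⟨n, hv⟩
    refine ⟨n % k, Nat.mod_lt _ (NeZero.pos k), ?_⟩
    have h1 : ((n % k : ℕ) : ZMod k) = n := by simp
    rwa [pos_mod_of_fixed c hk hq, h1]
  · rintro ⟨n, -, hv⟩
    exact ⟨n, hv⟩

/-- A fixed point of the Poincaré map whose orbit crosses transversally gives a crossing periodic
orbit. -/
theorem isCrossingPeriodicOrbit_trace [NeZero k] {q : ℝ × ℝ} (hq : c.pos k q = q.2)
    (hf : ∀ n < k, c.Follows q n) (hc : ∀ n < k, S.IsCrossing q.1 (x n, c.pos n q)) :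
    S.IsCrossingPeriodicOrbit q.1 (c.trace q) := by
  refine ⟨k, fun n => z n, fun n => (x n, c.pos n q),
    fun n t => S.flow q.1 (z n) t (x n, c.pos n q), fun n => c.time n (q.1, c.pos n q),
    NeZero.pos k, ?_, fun n hn => ⟨hc n hn, hf n hn⟩, c.trace_eq_of_fixed hq⟩
  simp only [hq, ZMod.natCast_self, Nat.cast_zero, pos]

/-- Data that confine the periodic orbits close to a cycle: the vertices of a periodic orbit lie
in balls of radius `ρ` about the vertices of the cycle, and the transition maps are under
control there. -/
structure Confined (ε ρ R : ℝ) : Prop where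
  le : ρ ≤ R / 2
  le_one : ρ ≤ 1
  sep : ∀ i j, dist ((x i, c.y i) : ℝ × ℝ) (x j, c.y j) < R →
    ((x i, c.y i) : ℝ × ℝ) = (x j, c.y j)
  regular : ∀ i s, |s - c.y i| < ρ → c.Regular i (ε, s) ∧ |c.step i (ε, s) - c.y (i + 1)| < R / 2
  mono : StrictMonoOn (fun s => c.pos k (ε, s)) (Ioo (c.y 0 - ρ) (c.y 0 + ρ))

/-- A crossing periodic orbit whose vertices are close to those of the cycle is the orbit of a
fixed point of the Poincaré map. -/
theorem Confined.exists_fixed [NeZero k] {c : Cycle S z x} {ε ρ R : ℝ} (hC : c.Confined ε ρ R)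
    {Γ : Set (ℝ × ℝ)} (hΓ : S.IsCrossingPeriodicOrbit ε Γ)
    (hsub : ∀ p ∈ Γ, p.1 = 1 ∨ p.1 = -1 → ∃ i, p ∈ Metric.ball ((x i, c.y i) : ℝ × ℝ) ρ) :
    ∃ s ∈ Ioo (c.y 0 - ρ) (c.y 0 + ρ), c.pos k (ε, s) = s ∧ Γ = c.trace (ε, s) := by
  obtain ⟨n, w, p, γ, T, hn, hper, hcross, harc, hun⟩ := hΓ.exists_chain
  have hpΓ : ∀ j, p j ∈ Γ := fun j => by
    rw [hun 0]
    refine mem_iUnion.2 ⟨j, 0, left_mem_Icc.2 ?_, ?_⟩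
    · rw [zero_add]
      exact (harc j).pos.le
    · rw [zero_add]
      exact (harc j).init
  have hnear : ∀ j i, p j ∈ Metric.ball ((x i, c.y i) : ℝ × ℝ) ρ →
      p j = (x i, (p j).2) ∧ |(p j).2 - c.y i| < ρ := by
    intro j i h
    rw [← ball_prod_same] at h
    have h1 : |(p j).1 - x i| < ρ := by simpa [Real.dist_eq] using h.1
    have h2 : |(p j).2 - c.y i| < ρ := by simpa [Real.dist_eq] using h.2
    refine ⟨Prod.ext ?_ rfl, h2⟩
    -- The switching lines are 2 apart and ρ ≤ 1, so a vertex in the ball lies on the line of its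
    -- centre.
    have h3 := abs_lt.1 (h1.trans_le hC.le_one)
    rcases (hcross j).line with h | h <;> rcases c.line i with h' | h' <;> rw [h, h'] at h3 ⊢ <;>
      norm_num at h3
  have hnext : ∀ j i, p j ∈ Metric.ball ((x i, c.y i) : ℝ × ℝ) ρ →
      p (j + 1) = (x (i + 1), c.step i (ε, (p j).2)) ∧
      γ j = (fun t => S.flow ε (z i) t (x i, (p j).2)) ∧ T j = c.time i (ε, (p j).2) := by
    intro j i h
    obtain ⟨h1, h2⟩ := hnear j i h
    have ha := harc j
    rw [h1] at ha
    exact (hC.regular i _ h2).1.unique ha (hcross (j + 1)).line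
  have hball : ∀ j i, p j ∈ Metric.ball ((x i, c.y i) : ℝ × ℝ) ρ →
      p (j + 1) ∈ Metric.ball ((x (i + 1), c.y (i + 1)) : ℝ × ℝ) ρ := by
    intro j i h
    obtain ⟨i', hi'⟩ := hsub _ (hpΓ (j + 1)) (hcross (j + 1)).line
    have h1 : dist (p (j + 1)) (x (i + 1), c.y (i + 1)) < R / 2 := by
      rw [(hnext j i h).1, Prod.dist_eq, dist_self, Real.dist_eq]
      have := (hC.regular i _ (hnear j i h).2).2
      exact max_lt (by linarith [abs_nonneg (c.step i (ε, (p j).2) - c.y (i + 1))]) this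
    -- The next vertex is within ρ ≤ R/2 of one vertex of the cycle and within R/2 of the expected
    -- one, so the two are less than R apart and coincide as points.
    have h2 := hC.sep i' (i + 1) (by
      have := dist_triangle_left ((x i', c.y i') : ℝ × ℝ) (x (i + 1), c.y (i + 1)) (p (j + 1))
      have h3 := Metric.mem_ball.1 hi'
      linarith [hC.le])
    rwa [h2] at hi'
  obtain ⟨i₀, hi₀⟩ := hsub _ (hpΓ 0) (hcross 0).line
  have hballs : ∀ j : ℕ, p j ∈ Metric.ball ((x (i₀ + j), c.y (i₀ + j)) : ℝ × ℝ) ρ := by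
    intro j
    induction j with
    | zero => simpa using hi₀
    | succ j ih =>
      have := hball j _ ih
      rwa [add_assoc, ← Nat.cast_succ] at this
  have hfollow : ∀ m : ℕ, i₀ + m = 0 → ∀ j : ℕ, p (m + j) = (x j, c.pos j (ε, (p m).2)) := by
    intro m hm j
    have hb : ∀ j : ℕ, p (m + j) ∈ Metric.ball ((x j, c.y j) : ℝ × ℝ) ρ := fun j => by
      have := hballs (m + j)
      rwa [Nat.cast_add, ← add_assoc, hm, zero_add] at this
    induction j with
    | zero => simpa [pos] using (hnear m 0 (by simpa using hb 0)).1
    | succ j ih =>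
      have := (hnext (m + j) j (hb j)).1
      rw [← add_assoc, this, ih, pos_succ, Nat.cast_succ]
  have hk : (k : ZMod k) = 0 := ZMod.natCast_self k
  -- Restart the chain at a vertex close to vertex 0 of the cycle; every k-th vertex from there is a
  -- return of the Poincaré map.
  obtain ⟨m, hm⟩ : ∃ m : ℕ, i₀ + m = 0 := ⟨(-i₀).val, by simp⟩
  have hmk : ∀ l : ℕ, i₀ + ((m + k * l : ℕ) : ZMod k) = 0 := fun l => by
    rw [Nat.cast_add, Nat.cast_mul, hk, zero_mul, add_zero, hm]
  let u : ℕ → ℝ := fun l => (p (m + k * l)).2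
  have hu : ∀ l, u l ∈ Ioo (c.y 0 - ρ) (c.y 0 + ρ) := fun l => by
    have h1 := hballs (m + k * l)
    rw [hmk] at h1
    have h2 := abs_sub_lt_iff.1 (hnear _ _ h1).2
    exact ⟨by linarith [h2.2], by linarith [h2.1]⟩
  have hustep : ∀ l, u (l + 1) = c.pos k (ε, u l) := fun l => by
    have := congrArg Prod.snd (hfollow _ (hmk l) k)
    rwa [add_assoc, ← Nat.mul_succ] at this
  have hun' : u n = u 0 := by
    simp only [u]
    rw [mul_comm k n, hper, mul_zero, add_zero]
  have hfix : c.pos k (ε, u 0) = u 0 := by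
    rw [← hustep 0]
    exact eq_of_periodic_of_strictMonoOn hC.mono hu hustep hn hun'
  refine ⟨u 0, hu 0, hfix, ?_⟩
  have hu0 : u 0 = (p m).2 := by simp [u]
  rw [hun m, trace, hu0]
  refine iUnion_congr fun j => ?_
  have h1 := hballs (m + j)
  rw [Nat.cast_add, ← add_assoc, hm, zero_add] at h1
  obtain ⟨-, h2, h3⟩ := hnext (m + j) j h1
  rw [h2, h3, hfollow m hm j]

theorem exists_sep [NeZero k] : ∃ R > 0, ∀ i j, dist ((x i, c.y i) : ℝ × ℝ) (x j, c.y j) < R →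
    ((x i, c.y i) : ℝ × ℝ) = (x j, c.y j) := by
  have h : ∀ᶠ R in 𝓝[>] (0 : ℝ), ∀ i j, dist ((x i, c.y i) : ℝ × ℝ) (x j, c.y j) < R →
      ((x i, c.y i) : ℝ × ℝ) = (x j, c.y j) := by
    refine eventually_all.2 fun i => eventually_all.2 fun j => ?_
    by_cases hij : ((x i, c.y i) : ℝ × ℝ) = (x j, c.y j)
    · exact Eventually.of_forall fun _ _ => hij
    · filter_upwards [Ioo_mem_nhdsGT (dist_pos.2 hij)] with R hR hlt
      exact absurd hlt (not_lt.2 hR.2.le)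
  obtain ⟨R, hR, hpos⟩ := (h.and self_mem_nhdsWithin).exists
  exact ⟨R, hpos, hR⟩

/-- At ε = 0 the Poincaré map is locally the identity, so its derivative is 1 there and stays
positive nearby by continuity. -/
theorem exists_strictMonoOn
    (hP : ∀ᶠ s in 𝓝 (c.y 0), c.pos k (0, s) = s) :
    ∃ ρ > 0, ∀ ε, |ε| < ρ → StrictMonoOn (fun s => c.pos k (ε, s)) (Ioo (c.y 0 - ρ) (c.y 0 + ρ)) := by
  have hcd := c.contDiffAt_pos k
  have hd : ∀ᶠ q : ℝ × ℝ in 𝓝 (0, c.y 0),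
      HasDerivAt (fun s => c.pos k (q.1, s)) (fderiv ℝ (c.pos k) q (0, 1)) q.2 := by
    filter_upwards [hcd.eventually (by simp)] with q h
    exact (h.differentiableAt (by norm_num)).hasFDerivAt.comp_hasDerivAt q.2
      ((hasDerivAt_const q.2 q.1).prodMk (hasDerivAt_id q.2))
  have h1 : fderiv ℝ (c.pos k) (0, c.y 0) (0, 1) = 1 :=
    hd.self_of_nhds.unique ((hasDerivAt_id (c.y 0)).congr_of_eventuallyEq hP)
  have hcont : ContinuousAt (fun q => fderiv ℝ (c.pos k) q (0, 1)) (0, c.y 0) :=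
    (hcd.fderiv_right (m := 0) (by norm_num)).continuousAt.clm_apply continuousAt_const
  have hpos : ∀ᶠ q in 𝓝 (0, c.y 0), 0 < fderiv ℝ (c.pos k) q (0, 1) :=
    hcont.eventually (eventually_gt_nhds (zero_lt_one.trans_eq h1.symm))
  obtain ⟨ρ, hρ, hball⟩ := Metric.eventually_nhds_iff_ball.1 (hd.and hpos)
  refine ⟨ρ, hρ, fun ε hε => ?_⟩
  have hmem : ∀ s ∈ Ioo (c.y 0 - ρ) (c.y 0 + ρ), (ε, s) ∈ Metric.ball ((0 : ℝ), c.y 0) ρ := by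
    intro s hs
    rw [← ball_prod_same, Real.ball_eq_Ioo (c.y 0)]
    exact ⟨by simpa using hε, hs⟩
  refine strictMonoOn_of_deriv_pos (convex_Ioo _ _)
    (fun s hs => (hball _ (hmem s hs)).1.continuousAt.continuousWithinAt) fun s hs => ?_
  rw [interior_Ioo] at hs
  rw [(hball _ (hmem s hs)).1.deriv]
  exact (hball _ (hmem s hs)).2

/-- The separation R of the finitely many vertices is fixed first; ρ is then shrunk until each
transition map sends the ρ-interval into the R/2-interval about the next vertex. The bound ρ ≤ r
keeps fixed points in the range where they are unique. -/
theorem exists_confined [NeZero k] (hP : ∀ᶠ s in 𝓝 (c.y 0), c.pos k (0, s) = s) {r : ℝ}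
    (hr : 0 < r) : ∃ ρ > 0, ρ ≤ r ∧ ∃ R, ∀ ε, |ε| < ρ → c.Confined ε ρ R := by
  obtain ⟨R, hR, hsep⟩ := c.exists_sep
  obtain ⟨ρ₁, hρ₁, hmono⟩ := c.exists_strictMonoOn hP
  have hloc : ∀ i, ∀ᶠ ρ in 𝓝[>] (0 : ℝ), ∀ ε s, |ε| < ρ → |s - c.y i| < ρ →
      c.Regular i (ε, s) ∧ |c.step i (ε, s) - c.y (i + 1)| < R / 2 := by
    intro i
    have h1 : ∀ᶠ q in 𝓝 (0, c.y i), |c.step i q - c.y (i + 1)| < R / 2 := by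
      have := (c.contDiffAt_step i).continuousAt.eventually
        (Metric.ball_mem_nhds (c.step i (0, c.y i)) (half_pos hR))
      filter_upwards [this] with q hq
      rwa [c.step_zero, Real.dist_eq] at hq
    obtain ⟨ρ, hρ, hball⟩ := Metric.eventually_nhds_iff_ball.1 ((c.eventually_regular i).and h1)
    filter_upwards [Ioo_mem_nhdsGT hρ] with ρ' hρ' ε s hε hs
    refine hball (ε, s) ?_
    rw [← ball_prod_same]
    refine ⟨?_, ?_⟩
    · simpa using hε.trans hρ'.2
    · simpa [Real.dist_eq] using hs.trans hρ'.2
  have hIoo : ∀ᶠ ρ in 𝓝[>] (0 : ℝ), ρ ∈ Ioo 0 (min (min r ρ₁) (min (R / 2) 1)) :=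
    Ioo_mem_nhdsGT (by positivity)
  obtain ⟨ρ, hall, hlt⟩ := ((eventually_all.2 hloc).and hIoo).exists
  have hlt' := hlt.2
  simp only [lt_min_iff] at hlt'
  refine ⟨ρ, hlt.1, hlt'.1.1.le, R, fun ε hε => ⟨hlt'.2.1.le, hlt'.2.2.le, hsep,
    fun i s hs => hall i ε s hε hs, (hmono ε (hε.trans hlt'.1.2)).mono (Ioo_subset_Ioo ?_ ?_)⟩⟩
  · linarith [hlt'.1.2]
  · linarith [hlt'.1.2]

/-- A simple zero of the first order displacement of the Poincaré map yields a unique limit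
cycle. -/
theorem uniqueLimitCycleNear [NeZero k] (hP : ∀ᶠ s in 𝓝 (c.y 0), c.pos k (0, s) = s)
    (hm : deriv (fun ε => c.pos k (ε, c.y 0)) 0 = 0)
    (hm' : deriv (fun s => deriv (fun ε => c.pos k (ε, s)) 0) (c.y 0) ≠ 0) :
    S.UniqueLimitCycleNear c.orbit := by
  obtain ⟨r, hr, hzero⟩ := exists_unique_zero_of_simple (F := fun q => c.pos k q - q.2)
    (y₀ := c.y 0) ((c.contDiffAt_pos k).sub contDiffAt_snd)
    (hP.mono fun s hs => by simp [hs])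
    (by simpa only [deriv_sub_const] using hm) (by simpa only [deriv_sub_const] using hm')
  obtain ⟨ρ, hρ, hρr, R, hconf⟩ := c.exists_confined hP hr
  obtain ⟨N, hNo, hN, hone⟩ := c.exists_nhd_no_oneZone
  -- A set inside B meets the switching lines only in the ρ-balls about the vertices, as
  -- `Confined.exists_fixed` requires.
  let B : Set (ℝ × ℝ) := {p | p.1 ≠ 1 ∧ p.1 ≠ -1} ∪ ⋃ i, Metric.ball ((x i, c.y i) : ℝ × ℝ) ρ
  have hBo : IsOpen B :=
    ((isOpen_ne_fun continuous_fst continuous_const).inter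
      (isOpen_ne_fun continuous_fst continuous_const)).union
      (isOpen_iUnion fun _ => Metric.isOpen_ball)
  have hB : c.orbit ⊆ B := by
    intro p hp
    obtain ⟨i, s, hs, rfl⟩ := mem_iUnion.1 hp
    by_cases hl : (c.γ i s).1 = 1 ∨ (c.γ i s).1 = -1
    · right
      rcases eq_or_lt_of_le hs.1 with rfl | h0
      · rw [(c.arc i).init]
        exact mem_iUnion.2 ⟨i, Metric.mem_ball_self hρ⟩
      rcases eq_or_lt_of_le hs.2 with rfl | h1
      · rw [(c.arc i).term]
        exact mem_iUnion.2 ⟨i + 1, Metric.mem_ball_self hρ⟩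
      exact absurd ((c.arc i).inside s ⟨h0, h1⟩) (notMem_region_of_line hl _)
    · left
      rwa [not_or] at hl
  -- This neighbourhood is fixed before U is given; only δ and ε₀ below depend on U.
  refine ⟨B ∩ N, hBo.inter hNo, subset_inter hB hN, fun U hU hLU => ?_⟩
  have hV : IsOpen (B ∩ N ∩ U) := (hBo.inter hNo).inter hU
  have hLV : c.orbit ⊆ B ∩ N ∩ U := subset_inter (subset_inter hB hN) hLU
  have hgood : ∀ᶠ q in 𝓝 (0, c.y 0), ∀ n ∈ Finset.range k, c.Follows q n ∧
      S.IsCrossing q.1 (x n, c.pos n q) ∧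
      (fun t => S.flow q.1 (z n) t (x n, c.pos n q)) '' Icc 0 (c.time n (q.1, c.pos n q)) ⊆
        B ∩ N ∩ U := by
    refine (Finset.eventually_all _).2 fun n _ => ?_
    refine (c.eventually_follows n).and (((c.tendsto_pos n).eventually (c.cross n).eventually).and ?_)
    have := S.eventually_flow_image_subset (z n) (x₀ := x n) (c.contDiffAt_time n).continuousAt
      ((c.eventually_arc_step n).mono fun q h => h.pos) hV (by
        rw [c.time_zero, ← (c.arc n).eq_flow]
        exact (subset_iUnion (fun i => c.γ i '' Icc 0 (c.T i)) (n : ZMod k)).trans hLV)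
    exact (c.tendsto_pos n).eventually this
  obtain ⟨δ, hδ, hball⟩ := Metric.eventually_nhds_iff_ball.1 hgood
  have hIoo : ∀ᶠ ε in 𝓝[>] (0 : ℝ), ε ∈ Ioo 0 (min δ ρ) := Ioo_mem_nhdsGT (lt_min hδ hρ)
  have hev := (hzero (min δ r) ⟨lt_min hδ hr, min_le_right _ _⟩).and
    (hIoo.and (hone.filter_mono nhdsWithin_le_nhds))
  obtain ⟨ε₀, hε₀, hsub⟩ := mem_nhdsGT_iff_exists_Ioo_subset.1 hev
  refine ⟨ε₀, hε₀, fun ε hε => ?_⟩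
  obtain ⟨⟨s, hs, hFs, huniq⟩, hεδ, hone⟩ := hsub hε
  have hεδ' := hεδ.2
  rw [lt_min_iff] at hεδ'
  have habs : |ε| = ε := abs_of_pos hεδ.1
  have hfix : c.pos k (ε, s) = s := sub_eq_zero.1 hFs
  have hmem : (ε, s) ∈ Metric.ball ((0 : ℝ), c.y 0) δ := by
    rw [← ball_prod_same, Real.ball_eq_Ioo (c.y 0)]
    refine ⟨by simpa [habs] using hεδ'.1, ?_, ?_⟩
    · linarith [hs.1, min_le_left δ r]
    · linarith [hs.2, min_le_left δ r]
  have hg := fun n (hn : n < k) => hball _ hmem n (Finset.mem_range.2 hn)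
  have hΓ : c.trace (ε, s) ⊆ B ∩ N ∩ U := by
    rw [c.trace_eq_of_fixed hfix]
    exact iUnion₂_subset fun n hn => (hg n hn).2.2
  have hun : ∀ Γ' ⊆ B ∩ N, S.IsPeriodicOrbit ε Γ' → Γ' = c.trace (ε, s) := by
    rintro Γ' hΓ' (hcr | hoz)
    · obtain ⟨s', hs', hfix', rfl⟩ := (hconf ε (by rw [habs]; exact hεδ'.2)).exists_fixed hcr
        (fun p hp hl => by
          rcases (hΓ' hp).1 with h | h
          · exact absurd hl (not_or.2 h)
          · exact mem_iUnion.1 h)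
      rw [huniq s' ⟨by linarith [hs'.1], by linarith [hs'.2]⟩ (sub_eq_zero.2 hfix')]
    · exact absurd hoz (hone Γ' (hΓ'.trans inter_subset_right))
  refine ⟨c.trace (ε, s), hΓ.trans inter_subset_left, hΓ.trans inter_subset_right,
    ⟨c.isCrossingPeriodicOrbit_trace hfix (fun n hn => (hg n hn).1) fun n hn => (hg n hn).2.1,
      B ∩ N, hBo.inter hNo, hΓ.trans inter_subset_left, hun⟩, hun⟩

end Cycle

end PWHam

namespace PWHam

/-! ### From a single cycle to a periodic annulus -/

/-- An injective continuous function on an interval is strictly monotone, and the intermediate value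
theorem fills the gap between end values. The vertices of the annulus thus cover a neighbourhood
even where the derivative of a vanishes. -/
theorem image_mem_nhds_of_injOn {J : Set ℝ} (hJ : IsOpen J) {a : ℝ → ℝ} (ha : ContinuousOn a J)
    (hinj : InjOn a J) {h : ℝ} (hh : h ∈ J) {V : Set ℝ} (hV : V ∈ 𝓝 h) : a '' V ∈ 𝓝 (a h) := by
  obtain ⟨r, hr, hball⟩ := Metric.mem_nhds_iff.1 (inter_mem hV (hJ.mem_nhds hh))
  have hsub : Icc (h - r / 2) (h + r / 2) ⊆ V ∩ J := by
    rw [← Real.closedBall_eq_Icc]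
    exact (Metric.closedBall_subset_ball (by linarith)).trans hball
  have hle : h - r / 2 ≤ h + r / 2 := by linarith
  have hl : h - r / 2 ∈ Icc (h - r / 2) (h + r / 2) := left_mem_Icc.2 hle
  have hm : h ∈ Icc (h - r / 2) (h + r / 2) := ⟨by linarith, by linarith⟩
  have hu : h + r / 2 ∈ Icc (h - r / 2) (h + r / 2) := right_mem_Icc.2 hle
  have hc := ha.mono fun t ht => (hsub ht).2
  have himg : a '' Icc (h - r / 2) (h + r / 2) ⊆ a '' V := image_mono fun t ht => (hsub ht).1
  rcases hc.strictMonoOn_of_injOn_Icc' hle (hinj.mono fun t ht => (hsub ht).2) with hmo | hmo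
  · exact mem_of_superset (Icc_mem_nhds (hmo hl hm (by linarith)) (hmo hm hu (by linarith)))
      ((intermediate_value_Icc hle hc).trans himg)
  · exact mem_of_superset (Icc_mem_nhds (hmo hm hu (by linarith)) (hmo hl hm (by linarith)))
      ((intermediate_value_Icc' hle hc).trans himg)

namespace Cycle

variable {S : Sys} {k : ℕ} {z : ZMod k → Zone} {x : ZMod k → ℝ}

theorem eventually_follows_lt (c : Cycle S z x) :
    ∀ᶠ q in 𝓝 (0, c.y 0), ∀ n < k, c.Follows q n := by
  have : ∀ᶠ q in 𝓝 (0, c.y 0), ∀ n ∈ Finset.range k, c.Follows q n :=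
    (Finset.eventually_all _).2 fun n _ => c.eventually_follows n
  exact this.mono fun q hq n hn => hq n (Finset.mem_range.2 hn)

theorem dy_start_ne_zero (c : Cycle S z x) : (S.H (z 0)).dy (x 0, c.y 0) ≠ 0 := by
  rw [← Sys.field_zero_fst]
  exact (c.arc 0).field_start_ne_zero (c.cross 0)

/-- The Poincaré map is the identity on cycles. -/
theorem pos_eq_of_follows [NeZero k] (c d : Cycle S z x)
    (hf : ∀ n < k, c.Follows (0, d.y 0) n) : c.pos k (0, d.y 0) = d.y 0 := by
  have := c.eq_pos_of_connects hf (s := fun n => d.y n) (by simp)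
    (fun n _ => ⟨_, _, by rw [Nat.cast_succ]; exact d.arc n⟩) k le_rfl
  rw [← this, ZMod.natCast_self]

/-- The maps of c and d come from implicit functions at different base points, but they agree
wherever both follow genuine arcs, so the variation computed at d applies to c. -/
theorem deriv_pos_eq_var (c d : Cycle S z x)
    (hf : ∀ᶠ q in 𝓝 (0, d.y 0), ∀ n < k, c.Follows q n) :
    deriv (fun ε => c.pos k (ε, d.y 0)) 0 = d.var k := by
  have ht : Tendsto (fun ε : ℝ => (ε, d.y 0)) (𝓝 0) (𝓝 (0, d.y 0)) :=
    (continuous_id.prodMk continuous_const).continuousAt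
  refine ((d.hasDerivAt_pos k).congr_of_eventuallyEq ?_).deriv
  filter_upwards [ht.eventually hf, ht.eventually d.eventually_follows_lt] with ε hc hd
  exact (c.eq_pos_of_connects hc (s := fun n => d.pos n (ε, d.y 0)) rfl
    (fun n hn => ⟨_, _, hd n hn⟩) k le_rfl).symm

/-- Simple zeros of the Melnikov function of a periodic annulus yield limit cycles. -/
theorem uniqueLimitCycleNear_of_annulus [NeZero k] {J : Set ℝ} (hJ : IsOpen J) {a : ℝ → ℝ}
    (ha : DifferentiableOn ℝ a J) (hinj : InjOn a J) (c : ∀ h ∈ J, Cycle S z x)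
    (hc : ∀ h hh, (c h hh).y 0 = a h) {M : ℝ → ℝ}
    (hM : ∀ h hh, M h = (S.H (z 0)).dy (x 0, a h) * (c h hh).var k) {h : ℝ} (hh : h ∈ J)
    (h0 : M h = 0) (h1 : deriv M h ≠ 0) : S.UniqueLimitCycleNear (c h hh).orbit := by
  set d := c h hh with hd
  have hda : HasDerivAt a (deriv a h) h := (ha.differentiableAt (hJ.mem_nhds hh)).hasDerivAt
  have hy : d.y 0 = a h := hc h hh
  have hat : Tendsto (fun h' => ((0 : ℝ), a h')) (𝓝 h) (𝓝 (0, d.y 0)) := by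
    rw [hy]
    exact (continuousAt_const.prodMk hda.continuousAt)
  -- `eventually_nhds` provides a full neighbourhood of each (0, a h'), as needed to differentiate
  -- in ε there.
  have hfol := hat.eventually (d.eventually_follows_lt.eventually_nhds)
  have hP : ∀ᶠ s in 𝓝 (d.y 0), d.pos k (0, s) = s := by
    have h2 : ∀ᶠ h' in 𝓝 h, d.pos k (0, a h') = a h' := by
      filter_upwards [hfol, hJ.mem_nhds hh] with h' hf hh'
      rw [← hc h' hh'] at hf ⊢
      exact d.pos_eq_of_follows (c h' hh') hf.self_of_nhds
    have h3 := image_mem_nhds_of_injOn hJ ha.continuousOn hinj hh h2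
    rw [hy]
    filter_upwards [h3] with s hs
    obtain ⟨h', hh', rfl⟩ := hs
    exact hh'
  let m : ℝ → ℝ := fun s => deriv (fun ε => d.pos k (ε, s)) 0
  have hMm : M =ᶠ[𝓝 h] fun h' => (S.H (z 0)).dy (x 0, a h') * m (a h') := by
    filter_upwards [hfol, hJ.mem_nhds hh] with h' hf hh'
    rw [hM h' hh']
    congr 1
    simp only [m]
    rw [← hc h' hh'] at hf ⊢
    exact (d.deriv_pos_eq_var (c h' hh') hf).symm
  have hK : (S.H (z 0)).dy (x 0, a h) ≠ 0 := by
    rw [← hy]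
    exact d.dy_start_ne_zero
  have hm0 : m (a h) = 0 := by
    have := hMm.self_of_nhds
    rw [h0] at this
    exact (mul_eq_zero.1 this.symm).resolve_left hK
  have hmd : HasDerivAt m (deriv m (a h)) (a h) := by
    rw [← hy]
    exact (differentiableAt_deriv_fst (d.contDiffAt_pos k)).hasDerivAt
  have hκ : DifferentiableAt ℝ (fun h' => (S.H (z 0)).dy (x 0, a h')) h := by
    have := hda.differentiableAt
    unfold Ham.dy
    fun_prop
  -- Because m(a h) = 0, the product rule leaves only the term H_y · m'(a h) · a'(h); hence m'(a h)
  -- = 0 would force M'(h) = 0, and a'(h) ≠ 0 need not be assumed.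
  have hMd := (hκ.hasDerivAt.mul (hmd.comp h hda)).congr_of_eventuallyEq hMm
  refine d.uniqueLimitCycleNear hP (by rw [hy]; exact hm0) fun hz => h1 ?_
  rw [hMd.deriv]
  rw [hy] at hz
  have hz' : deriv m (a h) = 0 := hz
  simp [hm0, hz']

end Cycle

/-! ### The three annuli -/

theorem forall_zmod_two {p : ZMod 2 → Prop} (h0 : p 0) (h1 : p 1) (i : ZMod 2) : p i := by
  fin_cases i
  exacts [h0, h1]

theorem forall_zmod_four {p : ZMod 4 → Prop} (h0 : p 0) (h1 : p 1) (h2 : p 2) (h3 : p 3)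
    (i : ZMod 4) : p i := by
  fin_cases i
  exacts [h0, h1, h2, h3]

theorem iUnion_zmod_two {α : Type*} (s : ZMod 2 → Set α) : ⋃ i, s i = s 0 ∪ s 1 := by
  refine (iUnion_subset (forall_zmod_two ?_ ?_)).antisymm
    (union_subset (subset_iUnion s 0) (subset_iUnion s 1))
  · exact subset_union_left
  · exact subset_union_right

theorem iUnion_zmod_four {α : Type*} (s : ZMod 4 → Set α) :
    ⋃ i, s i = s 0 ∪ s 1 ∪ s 2 ∪ s 3 := by
  refine (iUnion_subset (forall_zmod_four ?_ ?_ ?_ ?_)).antisymm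
    (union_subset (union_subset (union_subset (subset_iUnion s 0) (subset_iUnion s 1))
      (subset_iUnion s 2)) (subset_iUnion s 3))
  all_goals
    intro v hv
    simp [hv]

variable {S : Sys}

namespace Annulus0

/-- The zones visited. -/
def zones : ZMod 4 → Zone := ![Zone.R, Zone.C, Zone.L, Zone.C]

/-- The abscissas of the vertices. -/
def abscissas : ZMod 4 → ℝ := ![1, 1, -1, -1]

/-- A periodic orbit of the annulus as a cycle of arcs. -/
def cycle (D : Annulus0 S) (h : ℝ) (hh : h ∈ D.J) : Cycle S zones abscissas where
  y := ![D.a h, D.a₁ h, D.a₂ h, D.a₃ h]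
  γ := ![D.γR h, D.γB h, D.γL h, D.γC h]
  T := ![D.TR h, D.TB h, D.TL h, D.TC h]
  cross := forall_zmod_four (D.cross h hh) (D.cross₁ h hh) (D.cross₂ h hh) (D.cross₃ h hh)
  arc := forall_zmod_four (D.arcR h hh) (D.arcB h hh) (D.arcL h hh) (D.arcC h hh)

theorem orbit_cycle (D : Annulus0 S) (h : ℝ) (hh : h ∈ D.J) :
    (D.cycle h hh).orbit = D.orbit h :=
  iUnion_zmod_four _

theorem M_eq (D : Annulus0 S) (h : ℝ) (hh : h ∈ D.J) :
    D.M h = (S.H (zones 0)).dy (abscissas 0, D.a h) * (D.cycle h hh).var 4 := by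
  -- The recursion unfolds by computation in `ZMod 4`: since 3 + 1 = 0, the last denominator is
  -- taken at A again. The zero is the initial variation.
  have hvar : (D.cycle h hh).var 4 =
      (S.lineInt Zone.C (D.γC h) (D.TC h) + (S.H Zone.C).dy (-1, D.a₃ h) *
      ((S.lineInt Zone.L (D.γL h) (D.TL h) + (S.H Zone.L).dy (-1, D.a₂ h) *
      ((S.lineInt Zone.C (D.γB h) (D.TB h) + (S.H Zone.C).dy (1, D.a₁ h) *
      ((S.lineInt Zone.R (D.γR h) (D.TR h) + (S.H Zone.R).dy (1, D.a h) * 0) /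
      (S.H Zone.R).dy (1, D.a₁ h))) / (S.H Zone.C).dy (-1, D.a₂ h))) /
      (S.H Zone.L).dy (-1, D.a₃ h))) / (S.H Zone.C).dy (1, D.a h) := rfl
  have hz : (S.H (zones 0)).dy (abscissas 0, D.a h) = (S.H Zone.R).dy (1, D.a h) := rfl
  rw [hvar, hz]
  simp only [M]
  ring

theorem isMelnikov (D : Annulus0 S) :
    Sys.IsMelnikov (S.H Zone.R) 1 S.Ret0 D.J D.a D.M := by
  intro h hh
  obtain ⟨ε₀, hε₀, hf, hO⟩ := (D.cycle h hh).melnikov rfl (S.H Zone.R)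
  refine ⟨ε₀, hε₀, fun ε => (D.cycle h hh).pos 4 (ε, D.a h), fun ε hε => ?_, ?_⟩
  · exact ⟨(D.cycle h hh).pos 1 (ε, D.a h), (D.cycle h hh).pos 2 (ε, D.a h),
      (D.cycle h hh).pos 3 (ε, D.a h), ⟨_, _, hf ε hε 0 (by norm_num)⟩,
      ⟨_, _, hf ε hε 1 (by norm_num)⟩, ⟨_, _, hf ε hε 2 (by norm_num)⟩,
      ⟨_, _, hf ε hε 3 (by norm_num)⟩⟩
  · rw [D.M_eq h hh]
    exact hO

theorem uniqueLimitCycleNear (D : Annulus0 S) {h : ℝ} (hh : h ∈ D.J) (h0 : D.M h = 0)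
    (h1 : deriv D.M h ≠ 0) : S.UniqueLimitCycleNear (D.orbit h) := by
  rw [← D.orbit_cycle h hh]
  exact Cycle.uniqueLimitCycleNear_of_annulus D.isOpen D.diff D.inj D.cycle (fun _ _ => rfl)
    D.M_eq hh h0 h1

end Annulus0

namespace Annulus1

/-- The zones visited. -/
def zones : ZMod 2 → Zone := ![Zone.R, Zone.C]

/-- The abscissas of the vertices. -/
def abscissas : ZMod 2 → ℝ := ![1, 1]

/-- A periodic orbit of the annulus as a cycle of arcs. -/
def cycle (D : Annulus1 S) (h : ℝ) (hh : h ∈ D.J) : Cycle S zones abscissas where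
  y := ![D.b h, D.b₁ h]
  γ := ![D.γR h, D.γC h]
  T := ![D.TR h, D.TC h]
  cross := forall_zmod_two (D.cross h hh) (D.cross₁ h hh)
  arc := forall_zmod_two (D.arcR h hh) (D.arcC h hh)

theorem orbit_cycle (D : Annulus1 S) (h : ℝ) (hh : h ∈ D.J) :
    (D.cycle h hh).orbit = D.orbit h :=
  iUnion_zmod_two _

theorem M_eq (D : Annulus1 S) (h : ℝ) (hh : h ∈ D.J) :
    D.M h = (S.H (zones 0)).dy (abscissas 0, D.b h) * (D.cycle h hh).var 2 := by
  have hvar : (D.cycle h hh).var 2 =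
      (S.lineInt Zone.C (D.γC h) (D.TC h) + (S.H Zone.C).dy (1, D.b₁ h) *
      ((S.lineInt Zone.R (D.γR h) (D.TR h) + (S.H Zone.R).dy (1, D.b h) * 0) /
      (S.H Zone.R).dy (1, D.b₁ h))) / (S.H Zone.C).dy (1, D.b h) := rfl
  have hz : (S.H (zones 0)).dy (abscissas 0, D.b h) = (S.H Zone.R).dy (1, D.b h) := rfl
  rw [hvar, hz]
  simp only [M]
  ring

theorem isMelnikov (D : Annulus1 S) :
    Sys.IsMelnikov (S.H Zone.R) 1 S.Ret1 D.J D.b D.M := by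
  intro h hh
  obtain ⟨ε₀, hε₀, hf, hO⟩ := (D.cycle h hh).melnikov rfl (S.H Zone.R)
  refine ⟨ε₀, hε₀, fun ε => (D.cycle h hh).pos 2 (ε, D.b h), fun ε hε => ?_, ?_⟩
  · exact ⟨(D.cycle h hh).pos 1 (ε, D.b h), ⟨_, _, hf ε hε 0 (by norm_num)⟩,
      ⟨_, _, hf ε hε 1 (by norm_num)⟩⟩
  · rw [D.M_eq h hh]
    exact hO

theorem uniqueLimitCycleNear (D : Annulus1 S) {h : ℝ} (hh : h ∈ D.J) (h0 : D.M h = 0)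
    (h1 : deriv D.M h ≠ 0) : S.UniqueLimitCycleNear (D.orbit h) := by
  rw [← D.orbit_cycle h hh]
  exact Cycle.uniqueLimitCycleNear_of_annulus D.isOpen D.diff D.inj D.cycle (fun _ _ => rfl)
    D.M_eq hh h0 h1

end Annulus1

namespace Annulus2

/-- The zones visited. -/
def zones : ZMod 2 → Zone := ![Zone.C, Zone.L]

/-- The abscissas of the vertices. -/
def abscissas : ZMod 2 → ℝ := ![-1, -1]

/-- A periodic orbit of the annulus as a cycle of arcs. -/
def cycle (D : Annulus2 S) (h : ℝ) (hh : h ∈ D.J) : Cycle S zones abscissas where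
  y := ![D.c h, D.c₁ h]
  γ := ![D.γC h, D.γL h]
  T := ![D.TC h, D.TL h]
  cross := forall_zmod_two (D.cross h hh) (D.cross₁ h hh)
  arc := forall_zmod_two (D.arcC h hh) (D.arcL h hh)

theorem orbit_cycle (D : Annulus2 S) (h : ℝ) (hh : h ∈ D.J) :
    (D.cycle h hh).orbit = D.orbit h :=
  iUnion_zmod_two _

/-- This chain starts with the central arc, so the outer factor is the y-derivative of the central
Hamiltonian. -/
theorem M_eq (D : Annulus2 S) (h : ℝ) (hh : h ∈ D.J) :
    D.M h = (S.H (zones 0)).dy (abscissas 0, D.c h) * (D.cycle h hh).var 2 := by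
  have hvar : (D.cycle h hh).var 2 =
      (S.lineInt Zone.L (D.γL h) (D.TL h) + (S.H Zone.L).dy (-1, D.c₁ h) *
      ((S.lineInt Zone.C (D.γC h) (D.TC h) + (S.H Zone.C).dy (-1, D.c h) * 0) /
      (S.H Zone.C).dy (-1, D.c₁ h))) / (S.H Zone.L).dy (-1, D.c h) := rfl
  have hz : (S.H (zones 0)).dy (abscissas 0, D.c h) = (S.H Zone.C).dy (-1, D.c h) := rfl
  rw [hvar, hz]
  simp only [M]
  ring

theorem isMelnikov (D : Annulus2 S) :
    Sys.IsMelnikov (S.H Zone.C) (-1) S.Ret2 D.J D.c D.M := by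
  intro h hh
  obtain ⟨ε₀, hε₀, hf, hO⟩ := (D.cycle h hh).melnikov rfl (S.H Zone.C)
  refine ⟨ε₀, hε₀, fun ε => (D.cycle h hh).pos 2 (ε, D.c h), fun ε hε => ?_, ?_⟩
  · exact ⟨(D.cycle h hh).pos 1 (ε, D.c h), ⟨_, _, hf ε hε 0 (by norm_num)⟩,
      ⟨_, _, hf ε hε 1 (by norm_num)⟩⟩
  · rw [D.M_eq h hh]
    exact hO

theorem uniqueLimitCycleNear (D : Annulus2 S) {h : ℝ} (hh : h ∈ D.J) (h0 : D.M h = 0)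
    (h1 : deriv D.M h ≠ 0) : S.UniqueLimitCycleNear (D.orbit h) := by
  rw [← D.orbit_cycle h hh]
  exact Cycle.uniqueLimitCycleNear_of_annulus D.isOpen D.diff D.inj D.cycle (fun _ _ => rfl)
    D.M_eq hh h0 h1

end Annulus2

end PWHam

theorem theorem2 (S : PWHam.Sys) (h1 : S.H1) (h2 : S.H2)
    (D₀ : PWHam.Annulus0 S) (D₁ : PWHam.Annulus1 S) (D₂ : PWHam.Annulus2 S) :
    (PWHam.Sys.IsMelnikov (S.H PWHam.Zone.R) 1 S.Ret0 D₀.J D₀.a D₀.M ∧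
      PWHam.Sys.IsMelnikov (S.H PWHam.Zone.R) 1 S.Ret1 D₁.J D₁.b D₁.M ∧
      PWHam.Sys.IsMelnikov (S.H PWHam.Zone.C) (-1) S.Ret2 D₂.J D₂.c D₂.M) ∧
    (∀ h ∈ D₀.J, D₀.M h = 0 → deriv D₀.M h ≠ 0 → S.UniqueLimitCycleNear (D₀.orbit h)) ∧
    (∀ h ∈ D₁.J, D₁.M h = 0 → deriv D₁.M h ≠ 0 → S.UniqueLimitCycleNear (D₁.orbit h)) ∧
    (∀ h ∈ D₂.J, D₂.M h = 0 → deriv D₂.M h ≠ 0 → S.UniqueLimitCycleNear (D₂.orbit h)) :=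
  ⟨⟨D₀.isMelnikov, D₁.isMelnikov, D₂.isMelnikov⟩,
    fun _ hh => D₀.uniqueLimitCycleNear hh, fun _ hh => D₁.uniqueLimitCycleNear hh,
    fun _ hh => D₂.uniqueLimitCycleNear hh⟩
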